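/- A Frobenius symbol is a two-row array $$\begin{pmatrix}\alpha_1&\alpha_2&\dots&\alpha_k\\ \beta_1&\beta_2&\dots&\beta_k\end{pmatrix},\qquad k\ge 0,$$ of nonnegative integers with $\alpha_1>\alpha_2>\dots>\alpha_k\ge 0$ and $\beta_1>\beta_2>\dots>\beta_k\ge 0$; its size is $k+\alpha_1+\dots+\alpha_k+\beta_1+\dots+\beta_k$. For $n\ge 0$, let $F_\phi(n)$ be the number of Frobenius symbols of size $n$ with no zero in the top row $(\alpha_1,\dots,\alpha_k)$, and let $F_0(n)$ be the number of Frobenius symbols of size $n$ that do contain a zero in the top row. Theorem 1.2. As $n\to\infty$, $$F_\phi(n)\sim F_0(n)\sim \frac{1}{8\sqrt{3}\,n}\,e^{\pi\sqrt{\frac{2}{3}n}}.$$ Here $f(n)\sim g(n)$ means that $f(n)/g(n)\to 1$ as $n\to\infty$. -/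

import Mathlib

/-- A Frobenius symbol: two sequences of nonnegative integers of the same length, each of them
strictly decreasing. The empty symbol is allowed. -/
@[ext]
structure FrobeniusSymbol where
  top : List ℕ
  bottom : List ℕ
  length_eq : top.length = bottom.length
  top_decreasing : top.Pairwise (· > ·)
  bottom_decreasing : bottom.Pairwise (· > ·)

namespace FrobeniusSymbol

/-- The size `k + α₁ + ⋯ + αₖ + β₁ + ⋯ + βₖ`, where `k` is the common length of the rows. -/
def size (s : FrobeniusSymbol) : ℕ :=
  s.top.length + s.top.sum + s.bottom.sum

/-- There are only finitely many symbols of a given size, so that the cardinalities below are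
genuine. -/
theorem finite_setOf_size_eq (n : ℕ) : {s : FrobeniusSymbol | s.size = n}.Finite := by
  have hinj : Function.Injective
      (fun s : FrobeniusSymbol => (s.top.toFinset, s.bottom.toFinset)) := by
    have key : ∀ l l' : List ℕ, l.Pairwise (· > ·) → l'.Pairwise (· > ·) →
        l.toFinset = l'.toFinset → l = l' := by
      intro l l' h h' he
      have hn : l.Nodup := h.imp (fun hab => ne_of_gt hab)
      have hn' : l'.Nodup := h'.imp (fun hab => ne_of_gt hab)
      exact (List.perm_of_nodup_nodup_toFinset_eq hn hn' he).eq_of_pairwise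
        (fun a b _ _ hab hba => absurd hab (lt_asymm hba)) h h'
    intro s t hst
    simp only [Prod.mk.injEq] at hst
    exact FrobeniusSymbol.ext
      (key _ _ s.top_decreasing t.top_decreasing hst.1)
      (key _ _ s.bottom_decreasing t.bottom_decreasing hst.2)
  refine Set.Finite.subset (Set.Finite.preimage hinj.injOn
    ((Finset.range (n + 1)).powerset ×ˢ (Finset.range (n + 1)).powerset).finite_toSet) ?_
  intro s hs
  have hs' : s.top.length + s.top.sum + s.bottom.sum = n := hs
  simp only [Set.mem_preimage, Finset.mem_coe, Finset.mem_product, Finset.mem_powerset]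
  constructor
  · intro a ha
    have := List.le_sum_of_mem (List.mem_toFinset.mp ha)
    exact Finset.mem_range.mpr (by omega)
  · intro a ha
    have := List.le_sum_of_mem (List.mem_toFinset.mp ha)
    exact Finset.mem_range.mpr (by omega)

end FrobeniusSymbol

/-- `F_φ(n)`: the number of Frobenius symbols of size `n` with no zero in the top row. -/
noncomputable def frobeniusNoZero (n : ℕ) : ℕ :=
  {s : FrobeniusSymbol | s.size = n ∧ 0 ∉ s.top}.ncard

/-- `F_0(n)`: the number of Frobenius symbols of size `n` with a zero in the top row. -/
noncomputable def frobeniusZero (n : ℕ) : ℕ :=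
  {s : FrobeniusSymbol | s.size = n ∧ 0 ∈ s.top}.ncard

/-!
The number of Frobenius symbols of size `n` is the number `p n` of partitions, with generating
function `1 / P q`, where `P q = ∏ (1 - q ^ n)` is `eulerProd`. The proof finds the generating
functions of the two classes of symbols and then applies the circle method to both.

*Generating functions.* Sorting the symbols by the length `k` of their rows gives
`∑ₖ q ^ (k²) / (q; q)_k²` for all symbols and `∑ₖ q ^ (k² + k) / (q; q)_k²` for those without a zero
in the top row. Both belong to the family `durfeeSeries q c j = ∑ₖ q ^ (k² + c k) /
((q; q)_k (q; q)_{k + j})`. Two contiguous relations show that the diagonal members `c = j` all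
equal `1 / P q` (`durfeeSeries_diag`) and, iterated, that the second sum is
`partialTheta q / P q` with `partialTheta q = ∑ (-1) ^ m q ^ (m (m + 1) / 2)`
(`durfeeSeries_one_zero`). Hence `F_φ` and `F_0` have the generating functions
`partialTheta q / P q` and `(1 - partialTheta q) / P q`.

*The numerators.* In a Stolz angle at `1` the function `partialTheta` is bounded and tends to
`1 / 2` (`norm_partialTheta_le`, `tendsto_partialTheta`), so each class takes half of `p n`.

*The circle method.* Let `H q / P q` have coefficients `a n`, with `H` bounded in Stolz angles and
tending to `L` at `1`. In Cauchy's formula on the circle `|q| = exp (-τ²)`, `n = π² / (6 τ⁴)`, put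
`q = exp (-τ² (1 - i τ u))`. The modular inversion of `P`, inherited from the Dedekind eta function
(`inv_eulerProd_exp_neg`), shows that the normalized integrand tends to `L exp (-π² u² / 6)` for
each `u`. Away from the positive axis a factorwise comparison of `P q` with `P |q|`
(`norm_eulerProd_ge`) gives a bound of order `1 / (1 + u²)` uniform in `τ`, so that dominated
convergence yields `a n ∼ L exp (π √(2 n / 3)) / (4 √3 n)` (`isEquivalent_coeff`). With `L = 1 / 2`
this is the theorem for both classes.
-/

open Filter Topology Finset Complex
open scoped Real

/-! ### Durfee rectangle series -/

/-- The infinite product `∏_{n ≥ 1} (1 - q ^ n)`, the reciprocal of the generating function of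
partitions. -/
noncomputable def eulerProd (q : ℂ) : ℂ := ∏' n : ℕ, (1 - q ^ (n + 1))

/-- The finite `q`-Pochhammer symbol `(q; q)_n = ∏_{1 ≤ i ≤ n} (1 - q ^ i)`. -/
noncomputable def qPoch (q : ℂ) (n : ℕ) : ℂ := ∏ i ∈ range n, (1 - q ^ (i + 1))

theorem qPoch_zero (q : ℂ) : qPoch q 0 = 1 := by simp [qPoch]

theorem qPoch_succ (q : ℂ) (n : ℕ) : qPoch q (n + 1) = qPoch q n * (1 - q ^ (n + 1)) := by
  simp [qPoch, prod_range_succ]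

theorem one_sub_pow_succ_ne_zero {q : ℂ} (hq : ‖q‖ < 1) (n : ℕ) : 1 - q ^ (n + 1) ≠ 0 := by
  intro h
  have h1 : ‖q‖ ^ (n + 1) = 1 := by
    rw [← norm_pow, ← sub_eq_zero.mp h, norm_one]
  exact absurd h1 (pow_lt_one₀ (norm_nonneg _) hq (Nat.succ_ne_zero n)).ne

theorem qPoch_ne_zero {q : ℂ} (hq : ‖q‖ < 1) (n : ℕ) : qPoch q n ≠ 0 :=
  prod_ne_zero_iff.mpr fun i _ => one_sub_pow_succ_ne_zero hq i

theorem eulerProd_ne_zero {q : ℂ} (hq : ‖q‖ < 1) : eulerProd q ≠ 0 := by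
  have h : Summable fun n : ℕ => ‖-q ^ (n + 1)‖ := by
    simpa using (summable_nat_add_iff 1).mpr (summable_geometric_of_lt_one (norm_nonneg q) hq)
  have := tprod_one_add_ne_zero_of_summable (f := fun n : ℕ => -q ^ (n + 1))
    (fun i => by simpa [sub_eq_add_neg] using one_sub_pow_succ_ne_zero hq i) h
  simpa [eulerProd, sub_eq_add_neg] using this

theorem tendsto_qPoch {q : ℂ} (hq : ‖q‖ < 1) :
    Tendsto (qPoch q) atTop (𝓝 (eulerProd q)) :=
  (ModularForm.multipliable_one_sub_pow hq).hasProd.tendsto_prod_nat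

theorem tendsto_inv_qPoch {q : ℂ} (hq : ‖q‖ < 1) :
    Tendsto (fun n => (qPoch q n)⁻¹) atTop (𝓝 (eulerProd q)⁻¹) :=
  (tendsto_qPoch hq).inv₀ (eulerProd_ne_zero hq)

theorem exists_norm_inv_qPoch_le {q : ℂ} (hq : ‖q‖ < 1) :
    ∃ M : ℝ, 0 ≤ M ∧ ∀ n, ‖(qPoch q n)⁻¹‖ ≤ M := by
  obtain ⟨M, hM⟩ := (Metric.isBounded_range_of_tendsto _ (tendsto_inv_qPoch hq)).exists_norm_le
  have h : ∀ n, ‖(qPoch q n)⁻¹‖ ≤ M := fun n => hM _ ⟨n, rfl⟩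
  exact ⟨M, (norm_nonneg _).trans (h 0), h⟩

/-- The general term `q ^ (k² + c k) / ((q; q)_k (q; q)_{k + j})` of a Durfee rectangle series. -/
noncomputable def durfeeTerm (q : ℂ) (c j k : ℕ) : ℂ :=
  q ^ (k * k + c * k) * (qPoch q k)⁻¹ * (qPoch q (k + j))⁻¹

/-- The Durfee rectangle series `∑ₖ q ^ (k² + c k) / ((q; q)_k (q; q)_{k + j})`. -/
noncomputable def durfeeSeries (q : ℂ) (c j : ℕ) : ℂ := ∑' k, durfeeTerm q c j k

theorem exists_norm_durfeeTerm_le {q : ℂ} (hq : ‖q‖ < 1) :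
    ∃ M : ℝ, 0 ≤ M ∧ ∀ c j k, ‖durfeeTerm q c j k‖ ≤ M * ‖q‖ ^ k := by
  obtain ⟨M, hM0, hM⟩ := exists_norm_inv_qPoch_le hq
  refine ⟨M * M, by positivity, fun c j k => ?_⟩
  have h1 : ‖q‖ ^ (k * k + c * k) ≤ ‖q‖ ^ k :=
    pow_le_pow_of_le_one (norm_nonneg _) hq.le (by nlinarith [Nat.zero_le (c * k)])
  calc ‖durfeeTerm q c j k‖
      = ‖q‖ ^ (k * k + c * k) * ‖(qPoch q k)⁻¹‖ * ‖(qPoch q (k + j))⁻¹‖ := by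
        simp only [durfeeTerm, norm_mul, norm_pow]
    _ ≤ ‖q‖ ^ k * M * M := by gcongr <;> exact hM _
    _ = M * M * ‖q‖ ^ k := by ring

theorem summable_durfeeTerm {q : ℂ} (hq : ‖q‖ < 1) (c j : ℕ) : Summable (durfeeTerm q c j) := by
  obtain ⟨M, -, hM⟩ := exists_norm_durfeeTerm_le hq
  exact Summable.of_norm_bounded
    ((summable_geometric_of_lt_one (norm_nonneg q) hq).mul_left M) (hM c j)

theorem exists_norm_durfeeSeries_le {q : ℂ} (hq : ‖q‖ < 1) :
    ∃ B : ℝ, ∀ c j, ‖durfeeSeries q c j‖ ≤ B := by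
  obtain ⟨M, -, hM⟩ := exists_norm_durfeeTerm_le hq
  exact ⟨_, fun c j => tsum_of_norm_bounded
    ((summable_geometric_of_lt_one (norm_nonneg q) hq).mul_left M).hasSum (hM c j)⟩

/-- Writing `1 = q ^ k + (1 - q ^ k)` in each term and cancelling `1 - q ^ k` against
`(q; q)_k`. -/
theorem durfeeSeries_eq_add {q : ℂ} (hq : ‖q‖ < 1) (c j : ℕ) :
    durfeeSeries q c j =
      durfeeSeries q (c + 1) j + q ^ (c + 1) * durfeeSeries q (c + 2) (j + 1) := by
  have hs := (summable_durfeeTerm hq c j).sub (summable_durfeeTerm hq (c + 1) j)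
  have h : durfeeSeries q c j - durfeeSeries q (c + 1) j =
      q ^ (c + 1) * durfeeSeries q (c + 2) (j + 1) := by
    rw [durfeeSeries, durfeeSeries, ← (summable_durfeeTerm hq c j).tsum_sub
      (summable_durfeeTerm hq (c + 1) j), hs.tsum_eq_zero_add, durfeeSeries, ← tsum_mul_left]
    have h0 : durfeeTerm q c j 0 - durfeeTerm q (c + 1) j 0 = 0 := by simp [durfeeTerm]
    rw [h0, zero_add]
    refine tsum_congr fun k => ?_
    have h1 := one_sub_pow_succ_ne_zero hq k
    have h2 := qPoch_ne_zero hq k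
    have h3 := qPoch_ne_zero hq (k + 1 + j)
    rw [durfeeTerm, durfeeTerm, durfeeTerm, show k + (j + 1) = k + 1 + j by ring, qPoch_succ q k]
    field_simp
    ring
  rw [← h]; ring

/-- Cancelling the last factor of `(q; q)_{k + j + 1}` in each term. -/
theorem durfeeSeries_eq_sub {q : ℂ} (hq : ‖q‖ < 1) (c j : ℕ) :
    durfeeSeries q c j =
      durfeeSeries q c (j + 1) - q ^ (j + 1) * durfeeSeries q (c + 1) (j + 1) := by
  rw [durfeeSeries, durfeeSeries, durfeeSeries, ← tsum_mul_left,
    ← (summable_durfeeTerm hq _ _).tsum_sub ((summable_durfeeTerm hq _ _).mul_left _)]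
  refine tsum_congr fun k => ?_
  have h1 := one_sub_pow_succ_ne_zero hq (k + j)
  have h2 := qPoch_ne_zero hq k
  have h3 := qPoch_ne_zero hq (k + j)
  rw [durfeeTerm, durfeeTerm, durfeeTerm, ← add_assoc k j 1, qPoch_succ q (k + j)]
  field_simp
  ring

/-- The difference `D j` of the two sides satisfies `D j = -q ^ (j + 1) D (j + 1)` and is bounded
in `j`, hence zero. -/
theorem durfeeSeries_diag_succ {q : ℂ} (hq : ‖q‖ < 1) (j : ℕ) :
    durfeeSeries q j j = durfeeSeries q (j + 1) (j + 1) := by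
  obtain ⟨B, hB⟩ := exists_norm_durfeeSeries_le hq
  have hD : ∀ j, durfeeSeries q j j - durfeeSeries q (j + 1) (j + 1) =
      -q ^ (j + 1) * (durfeeSeries q (j + 1) (j + 1) - durfeeSeries q (j + 2) (j + 2)) := by
    intro j
    rw [durfeeSeries_eq_sub hq j j, durfeeSeries_eq_add hq j (j + 1)]
    ring
  have hb : ∀ n j, ‖durfeeSeries q j j - durfeeSeries q (j + 1) (j + 1)‖ ≤
      ‖q‖ ^ n * (B + B) := by
    intro n
    induction n with
    | zero => intro j; simpa using (norm_sub_le _ _).trans (add_le_add (hB _ _) (hB _ _))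
    | succ n ih =>
      intro j
      have h1 : ‖q‖ ^ (j + 1) ≤ ‖q‖ := by
        simpa using pow_le_pow_of_le_one (norm_nonneg q) hq.le (Nat.le_add_left 1 j)
      rw [hD, norm_mul, norm_neg, norm_pow, pow_succ' ‖q‖ n, mul_assoc]
      exact mul_le_mul h1 (ih (j + 1)) (norm_nonneg _) (norm_nonneg _)
  have hlim : Tendsto (fun n : ℕ => ‖q‖ ^ n * (B + B)) atTop (𝓝 0) := by
    simpa using (tendsto_pow_atTop_nhds_zero_of_lt_one (norm_nonneg q) hq).mul_const (B + B)
  exact sub_eq_zero.mp (norm_le_zero_iff.mp (ge_of_tendsto' hlim fun n => hb n j))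

/-- Only the term `k = 0` survives as `j → ∞`. -/
theorem tendsto_durfeeSeries_diag {q : ℂ} (hq : ‖q‖ < 1) :
    Tendsto (fun j => durfeeSeries q j j) atTop (𝓝 (eulerProd q)⁻¹) := by
  obtain ⟨M, -, hM⟩ := exists_norm_durfeeTerm_le hq
  have h := tendsto_tsum_of_dominated_convergence (𝓕 := atTop)
    (f := fun j k => durfeeTerm q j j k)
    (g := fun k => if k = 0 then (eulerProd q)⁻¹ else 0)
    ((summable_geometric_of_lt_one (norm_nonneg q) hq).mul_left M) ?_
    (.of_forall fun j k => hM j j k)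
  · simpa [durfeeSeries] using h
  · intro k
    rcases Nat.eq_zero_or_pos k with rfl | hk
    · simpa [durfeeTerm, qPoch_zero] using tendsto_inv_qPoch hq
    · rw [if_neg hk.ne']
      have h1 : Tendsto (fun j : ℕ => q ^ (k * k + j * k)) atTop (𝓝 0) :=
        (tendsto_pow_atTop_nhds_zero_of_norm_lt_one hq).comp
          (tendsto_atTop_mono
            (fun j => (Nat.le_mul_of_pos_right j hk).trans (Nat.le_add_left _ _)) tendsto_id)
      have h2 : Tendsto (fun j => (qPoch q (k + j))⁻¹) atTop (𝓝 (eulerProd q)⁻¹) :=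
        (tendsto_inv_qPoch hq).comp
          (tendsto_atTop_mono (fun j => Nat.le_add_left j k) tendsto_id)
      simpa [durfeeTerm] using (h1.mul_const (qPoch q k)⁻¹).mul h2

/-- Durfee's identity: decomposing a partition by its largest `k × (k + j)` rectangle. -/
theorem durfeeSeries_diag {q : ℂ} (hq : ‖q‖ < 1) (j : ℕ) :
    durfeeSeries q j j = (eulerProd q)⁻¹ := by
  have h0 : ∀ j, durfeeSeries q j j = durfeeSeries q 0 0 := by
    intro j
    induction j with
    | zero => rfl
    | succ j ih => rw [← durfeeSeries_diag_succ hq, ih]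
  have h := tendsto_durfeeSeries_diag hq
  simp only [h0] at h
  rw [h0, tendsto_nhds_unique h tendsto_const_nhds]

/-- The triangular number `m (m + 1) / 2`. -/
def triangular (m : ℕ) : ℕ := ∑ i ∈ range (m + 1), i

theorem triangular_succ (m : ℕ) : triangular (m + 1) = triangular m + (m + 1) :=
  sum_range_succ _ _

theorem triangular_zero : triangular 0 = 0 := rfl

theorem le_triangular (m : ℕ) : m ≤ triangular m := by
  induction m with
  | zero => exact Nat.zero_le _
  | succ m ih => rw [triangular_succ]; omega

/-- The partial theta function `∑_{m ≥ 0} (-1) ^ m q ^ (m (m + 1) / 2)`. -/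
noncomputable def partialTheta (q : ℂ) : ℂ := ∑' m : ℕ, (-1) ^ m * q ^ triangular m

theorem summable_norm_pow_triangular {q : ℂ} (hq : ‖q‖ < 1) :
    Summable fun m : ℕ => ‖q‖ ^ triangular m :=
  Summable.of_nonneg_of_le (fun _ => by positivity)
    (fun m => pow_le_pow_of_le_one (norm_nonneg q) hq.le (le_triangular m))
    (summable_geometric_of_lt_one (norm_nonneg q) hq)

theorem summable_partialTheta {q : ℂ} (hq : ‖q‖ < 1) :
    Summable fun m : ℕ => (-1) ^ m * q ^ triangular m :=
  Summable.of_norm_bounded (summable_norm_pow_triangular hq) (fun m => by simp)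

/-- Iterating `durfeeSeries_eq_add` along the diagonal, where Durfee's identity applies at each
step. -/
theorem durfeeSeries_one_zero {q : ℂ} (hq : ‖q‖ < 1) :
    durfeeSeries q 1 0 = partialTheta q * (eulerProd q)⁻¹ := by
  obtain ⟨B, hB⟩ := exists_norm_durfeeSeries_le hq
  have hrec : ∀ N, (∑ m ∈ range N, (-1) ^ m * q ^ triangular m) * (eulerProd q)⁻¹ =
      durfeeSeries q 1 0 - (-1) ^ N * q ^ triangular N * durfeeSeries q (N + 1) N := by
    intro N
    induction N with
    | zero => simp [triangular_zero]
    | succ N ih =>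
      rw [sum_range_succ, add_mul, ih, ← durfeeSeries_diag hq N, durfeeSeries_eq_add hq N N,
        triangular_succ]
      ring
  have hz : Tendsto (fun N => (-1) ^ N * q ^ triangular N * durfeeSeries q (N + 1) N) atTop
      (𝓝 0) := by
    refine squeeze_zero_norm (a := fun N => ‖q‖ ^ triangular N * B) (fun N => ?_) ?_
    · simp only [norm_mul, norm_pow, norm_neg, norm_one, one_pow, one_mul]
      gcongr
      exact hB _ _
    · simpa using (summable_norm_pow_triangular hq).tendsto_atTop_zero.mul_const B
  have h1 := ((summable_partialTheta hq).hasSum.tendsto_sum_nat).mul_const (eulerProd q)⁻¹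
  simp only [hrec] at h1
  have h2 := (tendsto_const_nhds (x := durfeeSeries q 1 0)).sub hz
  rw [sub_zero] at h2
  exact tendsto_nhds_unique h2 h1

/-! ### Generating functions of Frobenius symbols -/

/-- Strictly decreasing lists of natural numbers of length `k`. -/
abbrev DecreasingList (k : ℕ) : Type := {l : List ℕ // l.length = k ∧ l.Pairwise (· > ·)}

namespace DecreasingList

/-- Build a decreasing list of length `k + 1` from its last entry `m` and the decreasing list of
the differences with `m + 1` of the other entries. -/
def snoc (k : ℕ) (p : ℕ × DecreasingList k) : DecreasingList (k + 1) :=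
  ⟨p.2.1.map (· + (p.1 + 1)) ++ [p.1], by simp [p.2.2.1], by
    rw [List.pairwise_append]
    refine ⟨?_, List.pairwise_singleton _ _, ?_⟩
    · exact p.2.2.2.map _ fun a b h => Nat.add_lt_add_right h _
    · intro a ha b hb
      obtain ⟨c, -, rfl⟩ := List.mem_map.mp ha
      rw [List.mem_singleton.mp hb]
      show p.1 < c + (p.1 + 1)
      omega⟩

theorem sum_map_add (l : List ℕ) (c : ℕ) : (l.map (· + c)).sum = l.sum + l.length * c := by
  induction l with
  | nil => simp
  | cons a l ih => simp only [List.map_cons, List.sum_cons, List.length_cons, ih]; ring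

theorem map_sub_add {l : List ℕ} {c : ℕ} (h : ∀ x ∈ l, c ≤ x) :
    (l.map (· - c)).map (· + c) = l := by
  rw [List.map_map]
  conv_rhs => rw [← List.map_id l]
  exact List.map_congr_left fun x hx => Nat.sub_add_cancel (h x hx)

theorem pairwise_map_sub {l : List ℕ} {c : ℕ} (h : ∀ x ∈ l, c ≤ x)
    (hl : l.Pairwise (· > ·)) : (l.map (· - c)).Pairwise (· > ·) := by
  rw [List.pairwise_map]
  refine hl.imp_of_mem fun {a b} ha hb hab => ?_
  have := h a ha
  have := h b hb
  show b - c < a - c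
  have : b < a := hab
  omega

theorem map_add_injective (c : ℕ) : Function.Injective fun l : List ℕ => l.map (· + c) :=
  List.map_injective_iff.mpr (add_left_injective c)

theorem snoc_bijective (k : ℕ) : Function.Bijective (snoc k) := by
  constructor
  · rintro ⟨m, l⟩ ⟨m', l'⟩ h
    have h1 := congrArg Subtype.val h
    simp only [snoc] at h1
    obtain ⟨h2, h3⟩ := List.append_inj' h1 rfl
    obtain rfl : m = m' := by simpa using h3
    have h4 : l = l' := Subtype.ext (map_add_injective _ h2)
    rw [h4]
  · rintro ⟨l, hl, hp⟩
    have hne : l ≠ [] := by rintro rfl; simp at hl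
    obtain ⟨l', m, rfl⟩ : ∃ l' m, l = l' ++ [m] :=
      ⟨l.dropLast, l.getLast hne, (List.dropLast_append_getLast hne).symm⟩
    rw [List.pairwise_append] at hp
    have hm : ∀ x ∈ l', m + 1 ≤ x := fun x hx => hp.2.2 x hx m (List.mem_singleton_self m)
    refine ⟨(m, ⟨l'.map (· - (m + 1)), by simpa using hl, pairwise_map_sub hm hp.1⟩), ?_⟩
    apply Subtype.ext
    simp only [snoc, map_sub_add hm]

theorem sum_snoc (k : ℕ) (p : ℕ × DecreasingList k) :
    (snoc k p).1.sum = (k + 1) * p.1 + (k + p.2.1.sum) := by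
  have h := p.2.2.1
  simp only [snoc, List.sum_append, sum_map_add, List.sum_singleton, h]
  ring

theorem summable_norm_pow_iff {ι : Type*} (w : ι → ℕ) (q : ℂ) :
    (Summable fun i => ‖q ^ w i‖) ↔ Summable fun i => ((‖q‖ : ℝ) : ℂ) ^ w i := by
  rw [← summable_norm_iff (f := fun i => ((‖q‖ : ℝ) : ℂ) ^ w i)]
  simp

/-- The generating function of decreasing lists of length `k`. -/
theorem hasSum_pow_sum (k : ℕ) : ∀ {q : ℂ}, ‖q‖ < 1 →
    HasSum (fun l : DecreasingList k => q ^ l.1.sum) (q ^ k.choose 2 * (qPoch q k)⁻¹) := by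
  induction k with
  | zero =>
    intro q _
    have : Unique (DecreasingList 0) :=
      { default := ⟨[], rfl, List.Pairwise.nil⟩
        uniq := fun l => Subtype.ext (List.length_eq_zero_iff.mp l.2.1) }
    convert hasSum_unique (fun l : DecreasingList 0 => q ^ l.1.sum) using 1
    rw [List.length_eq_zero_iff.mp (default : DecreasingList 0).2.1]
    simp [qPoch_zero]
  | succ k ih =>
    intro q hq
    have hq' : ‖q ^ (k + 1)‖ < 1 := by
      rw [norm_pow]; exact pow_lt_one₀ (norm_nonneg _) hq (Nat.succ_ne_zero k)
    have h1 : HasSum (fun m : ℕ => (q ^ (k + 1)) ^ m) (1 - q ^ (k + 1))⁻¹ :=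
      hasSum_geometric_of_norm_lt_one hq'
    have h2 : HasSum (fun l : DecreasingList k => q ^ k * q ^ l.1.sum)
        (q ^ k * (q ^ k.choose 2 * (qPoch q k)⁻¹)) := (ih hq).mul_left _
    have h1n : Summable fun m : ℕ => ‖(q ^ (k + 1)) ^ m‖ := by
      simpa using summable_geometric_of_lt_one (norm_nonneg _) hq'
    have h2n : Summable fun l : DecreasingList k => ‖q ^ k * q ^ l.1.sum‖ := by
      simp only [norm_mul (q ^ k)]
      exact ((summable_norm_pow_iff (fun l : DecreasingList k => l.1.sum) q).mpr
        (ih (q := ((‖q‖ : ℝ) : ℂ)) (by simpa using hq)).summable).mul_left _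
    have h3 : HasSum
        (fun p : ℕ × DecreasingList k => (q ^ (k + 1)) ^ p.1 * (q ^ k * q ^ p.2.1.sum))
        ((1 - q ^ (k + 1))⁻¹ * (q ^ k * (q ^ k.choose 2 * (qPoch q k)⁻¹))) :=
      HasSum.mul (f := fun m : ℕ => (q ^ (k + 1)) ^ m)
        (g := fun l : DecreasingList k => q ^ k * q ^ l.1.sum) h1 h2
        (summable_mul_of_summable_norm (f := fun m : ℕ => (q ^ (k + 1)) ^ m)
          (g := fun l : DecreasingList k => q ^ k * q ^ l.1.sum) h1n h2n)
    have hval : q ^ (k + 1).choose 2 * (qPoch q (k + 1))⁻¹ =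
        (1 - q ^ (k + 1))⁻¹ * (q ^ k * (q ^ k.choose 2 * (qPoch q k)⁻¹)) := by
      rw [qPoch_succ, Nat.choose_succ_succ' k 1, Nat.choose_one_right, pow_add, mul_inv]
      ring
    rw [← (Equiv.ofBijective _ (snoc_bijective k)).hasSum_iff, hval]
    refine h3.congr_fun fun p => ?_
    simp only [Function.comp, Equiv.ofBijective_apply, sum_snoc, pow_add, pow_mul]

/-- Raising all entries by one is a bijection onto the decreasing lists without a zero. -/
def raise (k : ℕ) (l : DecreasingList k) : {l : DecreasingList k // 0 ∉ l.1} :=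
  ⟨⟨l.1.map (· + 1), by simp [l.2.1], l.2.2.map _ fun _ _ h => Nat.add_lt_add_right h _⟩,
    by simp⟩

theorem raise_bijective (k : ℕ) : Function.Bijective (raise k) := by
  constructor
  · intro l l' h
    exact Subtype.ext (map_add_injective 1 (congrArg (fun x => x.1.1) h))
  · rintro ⟨⟨l, hl, hp⟩, h0⟩
    have hm : ∀ x ∈ l, 1 ≤ x := fun x hx => Nat.one_le_iff_ne_zero.mpr (by rintro rfl; exact h0 hx)
    refine ⟨⟨l.map (· - 1), by simpa using hl, pairwise_map_sub hm hp⟩, ?_⟩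
    apply Subtype.ext
    apply Subtype.ext
    simp only [raise, map_sub_add hm]

theorem hasSum_pow_sum_of_zero_notMem (k : ℕ) {q : ℂ} (hq : ‖q‖ < 1) :
    HasSum (fun l : {l : DecreasingList k // 0 ∉ l.1} => q ^ l.1.1.sum)
      (q ^ (k + k.choose 2) * (qPoch q k)⁻¹) := by
  rw [← (Equiv.ofBijective _ (raise_bijective k)).hasSum_iff, pow_add, mul_assoc]
  refine ((hasSum_pow_sum k hq).mul_left (q ^ k)).congr_fun fun l => ?_
  simp only [Function.comp, Equiv.ofBijective_apply, raise, sum_map_add, l.2.1]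
  ring

end DecreasingList

/-- Grouping the terms of `∑ q ^ w i` by the value of the weight `w`. -/
theorem hasSum_ncard_mul_pow {ι : Type*} {w : ι → ℕ} (hw : ∀ n, {i | w i = n}.Finite) {q S : ℂ}
    (h : HasSum (fun i => q ^ w i) S) :
    HasSum (fun n : ℕ => ({i | w i = n}.ncard : ℂ) * q ^ n) S := by
  rw [← (Equiv.sigmaFiberEquiv w).hasSum_iff] at h
  refine h.sigma fun n => ?_
  have : Fintype {i // w i = n} := (hw n).fintype
  convert hasSum_fintype (fun i : {i // w i = n} => q ^ n) using 1
  · funext i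
    simp [i.2]
  · rw [sum_const, nsmul_eq_mul, Set.ncard_eq_toFinset_card _ (hw n), card_univ]
    congr 2
    exact (Fintype.card_of_subtype _ (by simp)).symm

/-- The product formula for the sum over pairs of rows of a common length. -/
theorem hasSum_sigma_mul {A B : ℕ → Type*} {f : ∀ k, A k → ℕ} {g : ∀ k, B k → ℕ}
    {a b : ℂ → ℕ → ℂ} (hf : ∀ {q : ℂ}, ‖q‖ < 1 → ∀ k, HasSum (fun x => q ^ f k x) (a q k))
    (hg : ∀ {q : ℂ}, ‖q‖ < 1 → ∀ k, HasSum (fun x => q ^ g k x) (b q k))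
    (hab : ∀ {q : ℂ}, ‖q‖ < 1 → Summable fun k => q ^ k * (a q k * b q k)) {q : ℂ}
    (hq : ‖q‖ < 1) :
    HasSum (fun x : Σ k, A k × B k => q ^ (x.1 + f x.1 x.2.1 + g x.1 x.2.2))
      (∑' k, q ^ k * (a q k * b q k)) := by
  have hk : ∀ {q : ℂ}, ‖q‖ < 1 → ∀ k, HasSum
      (fun x : A k × B k => q ^ (k + f k x.1 + g k x.2)) (q ^ k * (a q k * b q k)) := by
    intro q hq k
    have hq' : ‖((‖q‖ : ℝ) : ℂ)‖ < 1 := by simpa using hq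
    have hs : Summable fun x : A k × B k => q ^ f k x.1 * q ^ g k x.2 :=
      summable_mul_of_summable_norm (f := fun x : A k => q ^ f k x)
        (g := fun x : B k => q ^ g k x)
        ((DecreasingList.summable_norm_pow_iff (f k) q).mpr (hf hq' k).summable)
        ((DecreasingList.summable_norm_pow_iff (g k) q).mpr (hg hq' k).summable)
    have h := (HasSum.mul (f := fun x : A k => q ^ f k x)
        (g := fun x : B k => q ^ g k x) (hf hq k) (hg hq k) hs).mul_left (q ^ k)
    refine h.congr_fun fun x => ?_
    rw [pow_add, pow_add, mul_assoc]
  refine HasSum.sigma_of_hasSum (hab hq).hasSum (fun k => hk hq k) ?_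
  have hq' : ‖((‖q‖ : ℝ) : ℂ)‖ < 1 := by simpa using hq
  apply Summable.of_norm
  rw [summable_sigma_of_nonneg fun _ => norm_nonneg _]
  have hr : ∀ k, HasSum (fun x : A k × B k => ‖q ^ (k + f k x.1 + g k x.2)‖)
      ‖((‖q‖ : ℝ) : ℂ) ^ k * (a (‖q‖ : ℝ) k * b (‖q‖ : ℝ) k)‖ := by
    intro k
    have h := hk hq' k
    have h' : HasSum (fun x : A k × B k => ((‖q ^ (k + f k x.1 + g k x.2)‖ : ℝ) : ℂ))
        (((‖q‖ : ℝ) : ℂ) ^ k * (a (‖q‖ : ℝ) k * b (‖q‖ : ℝ) k)) := by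
      simpa using h
    have h3 : Summable fun x : A k × B k => ‖q ^ (k + f k x.1 + g k x.2)‖ :=
      Complex.summable_ofReal.mp h'.summable
    have h4 := h3.hasSum
    rw [h'.unique (Complex.hasSum_ofReal.mpr h4), Complex.norm_real,
      Real.norm_of_nonneg (tsum_nonneg fun _ => norm_nonneg _)]
    exact h4
  refine ⟨fun k => (hr k).summable, ?_⟩
  simp only [(hr _).tsum_eq]
  exact (hab hq').norm

namespace FrobeniusSymbol

/-- A Frobenius symbol is a pair of decreasing lists of the same length. -/
def equivSigma : (Σ k, DecreasingList k × DecreasingList k) ≃ FrobeniusSymbol where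
  toFun x := ⟨x.2.1.1, x.2.2.1, x.2.1.2.1.trans x.2.2.2.1.symm, x.2.1.2.2, x.2.2.2.2⟩
  invFun s := ⟨s.top.length, ⟨s.top, rfl, s.top_decreasing⟩,
    ⟨s.bottom, s.length_eq.symm, s.bottom_decreasing⟩⟩
  left_inv := by
    rintro ⟨k, ⟨l, rfl, hl⟩, ⟨l', h, hl'⟩⟩
    rfl
  right_inv s := rfl

/-- A Frobenius symbol without a zero in its top row is a pair of decreasing lists of the same
length, the first of them without a zero. -/
def equivSigmaNoZero :
    (Σ k, {l : DecreasingList k // 0 ∉ l.1} × DecreasingList k) ≃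
      {s : FrobeniusSymbol // 0 ∉ s.top} where
  toFun x := ⟨⟨x.2.1.1.1, x.2.2.1, x.2.1.1.2.1.trans x.2.2.2.1.symm, x.2.1.1.2.2, x.2.2.2.2⟩,
    x.2.1.2⟩
  invFun s := ⟨s.1.top.length, ⟨⟨s.1.top, rfl, s.1.top_decreasing⟩, s.2⟩,
    ⟨s.1.bottom, s.1.length_eq.symm, s.1.bottom_decreasing⟩⟩
  left_inv := by
    rintro ⟨k, ⟨⟨l, rfl, hl⟩, h0⟩, ⟨l', h, hl'⟩⟩
    rfl
  right_inv s := rfl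

theorem add_two_mul_choose_two (k : ℕ) : k + (k.choose 2 + k.choose 2) = k * k := by
  induction k with
  | zero => rfl
  | succ k ih =>
    rw [Nat.choose_succ_succ' k 1, Nat.choose_one_right]
    linarith

theorem durfeeTerm_zero_zero (q : ℂ) (k : ℕ) :
    q ^ k * (q ^ k.choose 2 * (qPoch q k)⁻¹ * (q ^ k.choose 2 * (qPoch q k)⁻¹)) =
      durfeeTerm q 0 0 k := by
  rw [durfeeTerm, ← add_two_mul_choose_two, pow_add, pow_add, pow_add, zero_mul, pow_zero,
    add_zero]
  ring

theorem durfeeTerm_one_zero (q : ℂ) (k : ℕ) :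
    q ^ k * (q ^ (k + k.choose 2) * (qPoch q k)⁻¹ * (q ^ k.choose 2 * (qPoch q k)⁻¹)) =
      durfeeTerm q 1 0 k := by
  rw [durfeeTerm, ← add_two_mul_choose_two, pow_add, pow_add, pow_add, pow_add, one_mul,
    add_zero]
  ring

theorem hasSum_pow_size {q : ℂ} (hq : ‖q‖ < 1) :
    HasSum (fun s : FrobeniusSymbol => q ^ s.size) (durfeeSeries q 0 0) := by
  rw [← equivSigma.hasSum_iff]
  have h := hasSum_sigma_mul (f := fun k (l : DecreasingList k) => l.1.sum)
    (g := fun k (l : DecreasingList k) => l.1.sum)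
    (a := fun q k => q ^ k.choose 2 * (qPoch q k)⁻¹)
    (b := fun q k => q ^ k.choose 2 * (qPoch q k)⁻¹)
    (fun hq k => DecreasingList.hasSum_pow_sum k hq)
    (fun hq k => DecreasingList.hasSum_pow_sum k hq)
    (fun hq => by simpa only [durfeeTerm_zero_zero] using summable_durfeeTerm hq 0 0) hq
  simp only [durfeeTerm_zero_zero] at h
  refine h.congr_fun fun x => ?_
  simp [equivSigma, size, x.2.1.2.1]

theorem hasSum_pow_size_of_zero_notMem {q : ℂ} (hq : ‖q‖ < 1) :
    HasSum (fun s : {s : FrobeniusSymbol // 0 ∉ s.top} => q ^ s.1.size) (durfeeSeries q 1 0) := by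
  rw [← equivSigmaNoZero.hasSum_iff]
  have h := hasSum_sigma_mul (f := fun k (l : {l : DecreasingList k // 0 ∉ l.1}) => l.1.1.sum)
    (g := fun k (l : DecreasingList k) => l.1.sum)
    (a := fun q k => q ^ (k + k.choose 2) * (qPoch q k)⁻¹)
    (b := fun q k => q ^ k.choose 2 * (qPoch q k)⁻¹)
    (fun hq k => DecreasingList.hasSum_pow_sum_of_zero_notMem k hq)
    (fun hq k => DecreasingList.hasSum_pow_sum k hq)
    (fun hq => by simpa only [durfeeTerm_one_zero] using summable_durfeeTerm hq 1 0) hq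
  simp only [durfeeTerm_one_zero] at h
  refine h.congr_fun fun x => ?_
  simp [equivSigmaNoZero, size, x.2.1.1.2.1]

end FrobeniusSymbol

theorem hasSum_frobeniusNoZero {q : ℂ} (hq : ‖q‖ < 1) :
    HasSum (fun n : ℕ => (frobeniusNoZero n : ℂ) * q ^ n)
      (partialTheta q * (eulerProd q)⁻¹) := by
  rw [← durfeeSeries_one_zero hq]
  have himg : ∀ n, Subtype.val '' {s : {s : FrobeniusSymbol // 0 ∉ s.top} | s.1.size = n} =
      {s : FrobeniusSymbol | s.size = n ∧ 0 ∉ s.top} := by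
    intro n
    ext s
    simp [and_comm]
  have hfin : ∀ n, {s : {s : FrobeniusSymbol // 0 ∉ s.top} | s.1.size = n}.Finite := fun n =>
    ((FrobeniusSymbol.finite_setOf_size_eq n).subset (by
      rw [himg]; exact fun s hs => hs.1)).of_finite_image Subtype.val_injective.injOn
  convert hasSum_ncard_mul_pow hfin (FrobeniusSymbol.hasSum_pow_size_of_zero_notMem hq) using 4
    with n
  rw [frobeniusNoZero, ← himg, Set.ncard_image_of_injective _ Subtype.val_injective]

theorem frobeniusNoZero_add_frobeniusZero (n : ℕ) :
    frobeniusNoZero n + frobeniusZero n = {s : FrobeniusSymbol | s.size = n}.ncard := by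
  have hfin := FrobeniusSymbol.finite_setOf_size_eq n
  rw [frobeniusNoZero, frobeniusZero, ← Set.ncard_union_eq
    (Set.disjoint_left.mpr fun s hs hs' => hs.2 hs'.2)
    (hfin.subset fun s hs => hs.1) (hfin.subset fun s hs => hs.1)]
  congr 1
  ext s
  simp only [Set.mem_union, Set.mem_ofPred_eq]
  tauto

theorem hasSum_frobeniusZero {q : ℂ} (hq : ‖q‖ < 1) :
    HasSum (fun n : ℕ => (frobeniusZero n : ℂ) * q ^ n)
      ((1 - partialTheta q) * (eulerProd q)⁻¹) := by
  have h := (hasSum_ncard_mul_pow FrobeniusSymbol.finite_setOf_size_eq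
    (FrobeniusSymbol.hasSum_pow_size hq)).sub (hasSum_frobeniusNoZero hq)
  rw [durfeeSeries_diag hq] at h
  rw [sub_mul, one_mul]
  refine h.congr_fun fun n => ?_
  rw [← frobeniusNoZero_add_frobeniusZero]
  push_cast
  ring

/-! ### The partial theta function near `1` -/

theorem norm_one_sub_pow_le_nat_mul {q : ℂ} (hq : ‖q‖ < 1) (n : ℕ) :
    ‖1 - q ^ n‖ ≤ n * ‖1 - q‖ := by
  rw [← mul_neg_geom_sum, norm_mul, mul_comm]
  gcongr
  refine (norm_sum_le _ _).trans ?_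
  refine (sum_le_sum (g := fun _ => (1 : ℝ)) fun i _ => ?_).trans (by simp)
  rw [norm_pow]
  exact pow_le_one₀ (norm_nonneg _) hq.le

theorem norm_one_sub_pow_le {q : ℂ} (hq : ‖q‖ < 1) (n : ℕ) :
    ‖1 - q ^ n‖ ≤ ‖1 - q‖ / (1 - ‖q‖) * (1 - ‖q‖ ^ n) := by
  have h : 0 < 1 - ‖q‖ := sub_pos.mpr hq
  rw [← mul_neg_geom_sum, ← mul_neg_geom_sum, norm_mul, ← mul_assoc, div_mul_cancel₀ _ h.ne']
  gcongr
  exact (norm_sum_le _ _).trans (by simp)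

/-- The terms with indices `2 k` and `2 k + 1` nearly cancel, and the resulting bounds telescope. -/
theorem norm_partialTheta_le {q : ℂ} (hq : ‖q‖ < 1) :
    ‖partialTheta q‖ ≤ ‖1 - q‖ / (1 - ‖q‖) := by
  have h : 0 < 1 - ‖q‖ := sub_pos.mpr hq
  set K := ‖1 - q‖ / (1 - ‖q‖) with hK
  have hK0 : 0 ≤ K := by positivity
  have hpart : ∀ N, ‖∑ m ∈ range (2 * N), (-1) ^ m * q ^ triangular m‖ ≤
      K * (1 - ‖q‖ ^ triangular (2 * N)) := by
    intro N
    induction N with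
    | zero => simp [triangular_zero]
    | succ N ih =>
      have hanti : ‖q‖ ^ triangular (2 * N + 2) ≤ ‖q‖ ^ triangular (2 * N + 1) :=
        pow_le_pow_of_le_one (norm_nonneg q) hq.le (by rw [triangular_succ (2 * N + 1)]; omega)
      have hpair : ‖q ^ triangular (2 * N) - q ^ triangular (2 * N + 1)‖ ≤
          K * (‖q‖ ^ triangular (2 * N) - ‖q‖ ^ triangular (2 * N + 1)) := by
        have h1 := norm_one_sub_pow_le hq (2 * N + 1)
        rw [triangular_succ, pow_add q (triangular _), pow_add ‖q‖ (triangular _),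
          ← mul_one_sub, ← mul_one_sub, norm_mul, norm_pow, mul_left_comm]
        exact mul_le_mul_of_nonneg_left h1 (by positivity)
      have hsum : ∑ m ∈ range (2 * (N + 1)), (-1) ^ m * q ^ triangular m =
          ∑ m ∈ range (2 * N), (-1) ^ m * q ^ triangular m +
            (q ^ triangular (2 * N) - q ^ triangular (2 * N + 1)) := by
        rw [show 2 * (N + 1) = 2 * N + 1 + 1 by ring, sum_range_succ, sum_range_succ, pow_succ,
          pow_mul]
        norm_num
        ring
      rw [hsum]
      refine (norm_add_le _ _).trans ((add_le_add ih hpair).trans ?_)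
      rw [show 2 * (N + 1) = 2 * N + 2 by ring]
      nlinarith [mul_le_mul_of_nonneg_left hanti hK0]
  have hlim := ((summable_partialTheta hq).hasSum.tendsto_sum_nat.comp
    (tendsto_atTop_mono (fun N : ℕ => (by omega : N ≤ 2 * N)) tendsto_id)).norm
  refine le_of_tendsto' hlim fun N => (hpart N).trans ?_
  exact mul_le_of_le_one_right hK0 (sub_le_self _ (by positivity))

/-- The Euler transform of an alternating series. -/
theorem two_mul_tsum_alternating {a : ℕ → ℂ} (ha : Summable fun m => (-1) ^ m * a m) :
    2 * ∑' m, (-1) ^ m * a m = a 0 + ∑' m, (-1) ^ m * (a m - a (m + 1)) := by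
  have h1 : Summable fun m => (-1) ^ (m + 1) * a (m + 1) :=
    (summable_nat_add_iff (f := fun m => (-1) ^ m * a m) 1).mpr ha
  have h2 : ∑' m, (-1) ^ m * (a m - a (m + 1)) =
      ∑' m, (-1) ^ m * a m + ∑' m, (-1) ^ (m + 1) * a (m + 1) := by
    rw [← ha.tsum_add h1]
    exact tsum_congr fun m => by ring
  have h3 := ha.tsum_eq_zero_add
  rw [pow_zero, one_mul] at h3
  rw [h2]
  linear_combination h3

/-- The Euler transform applied twice, which makes second differences appear. -/
theorem four_mul_partialTheta {q : ℂ} (hq : ‖q‖ < 1) :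
    4 * partialTheta q = 2 + (1 - q) + ∑' m : ℕ, (-1) ^ m *
      (q ^ triangular m * ((1 - q ^ (m + 1)) ^ 2 - q ^ (2 * m + 2) * (1 - q))) := by
  have h1 := two_mul_tsum_alternating (a := fun m => q ^ triangular m) (summable_partialTheta hq)
  have hs : Summable fun m => (-1) ^ m * (q ^ triangular m - q ^ triangular (m + 1)) := by
    have h := (summable_partialTheta hq).add
      ((summable_nat_add_iff (f := fun m => (-1) ^ m * q ^ triangular m) 1).mpr
        (summable_partialTheta hq))
    exact h.congr fun m => by ring
  have h2 := two_mul_tsum_alternating hs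
  have h3 : ∀ m : ℕ, q ^ triangular m - q ^ triangular (m + 1) -
      (q ^ triangular (m + 1) - q ^ triangular (m + 1 + 1)) =
      q ^ triangular m * ((1 - q ^ (m + 1)) ^ 2 - q ^ (2 * m + 2) * (1 - q)) := by
    intro m
    rw [triangular_succ (m + 1), triangular_succ m]
    ring
  simp only [h3, triangular_succ 0, triangular_zero, pow_zero, zero_add, pow_one] at h1 h2
  rw [partialTheta]
  linear_combination 2 * h1 + h2

theorem succ_sq_le_four_mul_triangular (m : ℕ) :
    ((m : ℝ) + 1) ^ 2 ≤ 4 * ((triangular m + 1 : ℕ) : ℝ) := by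
  have h : ((triangular m : ℕ) : ℝ) * 2 = m * (m + 1) := by
    induction m with
    | zero => simp [triangular_zero]
    | succ m ih => rw [triangular_succ]; push_cast; linarith
  push_cast
  nlinarith [sq_nonneg ((m : ℝ) - 1), Nat.cast_nonneg (α := ℝ) m]

/-- The second differences of `q ^ (m (m + 1) / 2)` are `O(1 / m²)`, uniformly for `q` near `1` in
a Stolz angle. -/
theorem norm_second_difference_le {q : ℂ} {K : ℝ} (hq : ‖q‖ < 1) (hq2 : 1 / 2 ≤ ‖q‖)
    (hK : ‖1 - q‖ ≤ K * (1 - ‖q‖)) (m : ℕ) :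
    ‖(-1) ^ m * (q ^ triangular m * ((1 - q ^ (m + 1)) ^ 2 - q ^ (2 * m + 2) * (1 - q)))‖ ≤
      (64 * K ^ 2 + 8 * K) * (1 / ((m : ℝ) + 1) ^ 2) := by
  set y := 1 - ‖q‖ with hy
  have hy0 : 0 < y := sub_pos.mpr hq
  have hK0 : 0 ≤ K := nonneg_of_mul_nonneg_left ((norm_nonneg _).trans hK) hy0
  set x := y * ((triangular m + 1 : ℕ) : ℝ) with hx
  have hx0 : 0 ≤ x := by positivity
  have hpow : ‖q‖ ^ triangular m ≤ 2 * Real.exp (-x) := by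
    have h1 : ‖q‖ ≤ Real.exp (-y) := by
      have := Real.add_one_le_exp (-y)
      linarith
    have h2 : ‖q‖ ^ (triangular m + 1) ≤ Real.exp (-x) := by
      refine (pow_le_pow_left₀ (norm_nonneg _) h1 _).trans_eq ?_
      rw [← Real.exp_nat_mul, hx]
      congr 1
      ring
    rw [pow_succ] at h2
    nlinarith [pow_nonneg (norm_nonneg q) (triangular m)]
  have he1 : x * Real.exp (-x) ≤ 1 := by
    have := Real.pow_div_factorial_le_exp x hx0 1
    rw [Real.exp_neg, ← div_eq_mul_inv, div_le_one (Real.exp_pos x)]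
    simpa using this
  have he2 : x ^ 2 * Real.exp (-x) ≤ 2 := by
    have := Real.pow_div_factorial_le_exp x hx0 2
    rw [Real.exp_neg, ← div_eq_mul_inv, div_le_iff₀ (Real.exp_pos x)]
    norm_num [Nat.factorial] at this
    linarith
  have hm := succ_sq_le_four_mul_triangular m
  set M := ((m : ℝ) + 1) ^ 2 with hM
  have hM0 : 0 < M := by positivity
  have hMy : M * y ≤ 4 * x := by
    rw [hx]; nlinarith
  have hA : ‖(1 - q ^ (m + 1)) ^ 2 - q ^ (2 * m + 2) * (1 - q)‖ ≤ K ^ 2 * (M * y ^ 2) + K * y := by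
    refine (norm_sub_le _ _).trans (add_le_add ?_ ?_)
    · rw [norm_pow]
      have h1 := norm_one_sub_pow_le_nat_mul hq (m + 1)
      have h2 : ‖1 - q ^ (m + 1)‖ ≤ ((m : ℝ) + 1) * (K * y) := by
        push_cast at h1
        exact h1.trans (mul_le_mul_of_nonneg_left hK (by positivity))
      refine (pow_le_pow_left₀ (norm_nonneg _) h2 2).trans_eq ?_
      rw [hM]; ring
    · rw [norm_mul, norm_pow]
      exact (mul_le_of_le_one_left (norm_nonneg _)
        (pow_le_one₀ (norm_nonneg _) hq.le)).trans hK
  rw [norm_mul, norm_mul, norm_pow, norm_neg, norm_one, one_pow, one_mul, norm_pow, mul_one_div,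
    le_div_iff₀ hM0]
  have hE : 0 < Real.exp (-x) := Real.exp_pos _
  have hMy2 : (M * y) ^ 2 ≤ (4 * x) ^ 2 := pow_le_pow_left₀ (by positivity) hMy 2
  calc ‖q‖ ^ triangular m * ‖(1 - q ^ (m + 1)) ^ 2 - q ^ (2 * m + 2) * (1 - q)‖ * M
      ≤ 2 * Real.exp (-x) * (K ^ 2 * (M * y ^ 2) + K * y) * M := by gcongr
    _ = 2 * Real.exp (-x) * (K ^ 2 * (M * y) ^ 2 + K * (M * y)) := by ring
    _ ≤ 2 * Real.exp (-x) * (K ^ 2 * (4 * x) ^ 2 + K * (4 * x)) := by gcongr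
    _ = 32 * K ^ 2 * (x ^ 2 * Real.exp (-x)) + 8 * K * (x * Real.exp (-x)) := by ring
    _ ≤ 32 * K ^ 2 * 2 + 8 * K * 1 := by gcongr
    _ = 64 * K ^ 2 + 8 * K := by ring

/-- The partial theta function tends to `1 / 2` as `q → 1` inside a Stolz angle. -/
theorem tendsto_partialTheta {α : Type*} {l : Filter α} {q : α → ℂ} {K : ℝ}
    (hq1 : Tendsto q l (𝓝 1)) (hq : ∀ᶠ a in l, ‖q a‖ < 1)
    (hK : ∀ᶠ a in l, ‖1 - q a‖ ≤ K * (1 - ‖q a‖)) :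
    Tendsto (fun a => partialTheta (q a)) l (𝓝 (1 / 2)) := by
  have hhalf : ∀ᶠ a in l, 1 / 2 ≤ ‖q a‖ := by
    have h := hq1.norm
    rw [norm_one] at h
    exact (h.eventually (lt_mem_nhds (by norm_num : (1 / 2 : ℝ) < 1))).mono fun _ h => h.le
  have hsum : Summable fun m : ℕ => (64 * K ^ 2 + 8 * K) * (1 / ((m : ℝ) + 1) ^ 2) := by
    refine Summable.mul_left _ ?_
    have := (summable_nat_add_iff 1).mpr (Real.summable_one_div_nat_pow.mpr one_lt_two)
    simpa using this
  have hT := tendsto_tsum_of_dominated_convergence (𝓕 := l)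
    (f := fun a (m : ℕ) => (-1) ^ m * ((q a) ^ triangular m *
      ((1 - (q a) ^ (m + 1)) ^ 2 - (q a) ^ (2 * m + 2) * (1 - q a))))
    (g := fun _ => 0) hsum ?_ ?_
  · have h4 : Tendsto (fun a => 4 * partialTheta (q a)) l (𝓝 (2 + (1 - 1) + 0)) := by
      rw [tsum_zero] at hT
      refine Tendsto.congr' ?_ ((tendsto_const_nhds.add (tendsto_const_nhds.sub hq1)).add hT)
      filter_upwards [hq] with a ha using (four_mul_partialTheta ha).symm
    have h5 := h4.const_mul (1 / 4)
    refine (h5.congr fun a => by ring).trans (by norm_num)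
  · intro m
    have hc : Continuous fun z : ℂ => (-1) ^ m * (z ^ triangular m *
        ((1 - z ^ (m + 1)) ^ 2 - z ^ (2 * m + 2) * (1 - z))) := by fun_prop
    simpa [Function.comp_def] using (hc.tendsto 1).comp hq1
  · filter_upwards [hq, hhalf, hK] with a h1 h2 h3 m using norm_second_difference_le h1 h2 h3 m

/-! ### The Euler product: modular inversion and lower bound -/

/-- The modular inversion of the Euler product, from that of the Dedekind eta function. -/
theorem inv_eulerProd_exp_neg (t : ℝ) (ht : 0 < t) (w : ℂ) (hw : 0 < w.re) :
    (eulerProd (exp (-(t * w))))⁻¹ =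
      Real.sqrt (t / (2 * π)) * ((sqrt I)⁻¹ * sqrt (I * w)) *
        exp (π ^ 2 / (6 * (t * w)) - t * w / 24) *
        (eulerProd (exp (-(4 * π ^ 2 / (t * w)))))⁻¹ := by
  have hw0 : w ≠ 0 := by rintro rfl; simp at hw
  have ht0 : (t : ℂ) ≠ 0 := ofReal_ne_zero.mpr ht.ne'
  have hpi : (π : ℂ) ≠ 0 := ofReal_ne_zero.mpr Real.pi_ne_zero
  set z : ℂ := ((t / (2 * π) : ℝ) : ℂ) * (I * w) with hz
  have hzim : 0 < z.im := by
    rw [hz, im_ofReal_mul]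
    have : (I * w).im = w.re := by simp
    rw [this]
    positivity
  have heta : ∀ x : ℂ, ModularForm.eta x =
      exp (2 * π * I * x / 24) * eulerProd (exp (2 * π * I * x)) := by
    intro x
    simp [ModularForm.eta, eulerProd, Function.Periodic.qParam, ModularForm.eta_q]
  have h := ModularForm.eta_comp_eq_csqrt_I_inv (x := z) hzim
  have h1 : 2 * π * I * z = -(t * w) := by
    rw [hz]; push_cast; field_simp; linear_combination I_sq
  have h2 : 2 * π * I * (-1 / z) = -(4 * π ^ 2 / (t * w)) := by
    rw [hz]; push_cast; field_simp; ring
  have hsq : sqrt z = Real.sqrt (t / (2 * π)) * sqrt (I * w) := by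
    have hr' : 0 < t / (2 * π) := by positivity
    have hr := hr'.le
    have hIw : I * w ≠ 0 := mul_ne_zero I_ne_zero hw0
    have hr0 : ((t / (2 * π) : ℝ) : ℂ) ≠ 0 := ofReal_ne_zero.mpr hr'.ne'
    have h3 : ((t / (2 * π) : ℝ) : ℂ) ^ (2⁻¹ : ℂ) = (Real.sqrt (t / (2 * π)) : ℝ) := by
      rw [Real.sqrt_eq_rpow, ofReal_cpow hr]
      norm_num
    rw [sqrt, sqrt, hz, ← h3, cpow_def_of_ne_zero (mul_ne_zero hr0 hIw), cpow_def_of_ne_zero hr0,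
      cpow_def_of_ne_zero hIw, log_ofReal_mul hr' hIw, ofReal_log hr, add_mul, exp_add]
  have hP1 : eulerProd (exp (-(t * w))) ≠ 0 := by
    apply eulerProd_ne_zero
    rw [norm_exp, Real.exp_lt_one_iff, neg_re, re_ofReal_mul]
    have := mul_pos ht hw
    linarith
  have hP2 : eulerProd (exp (-(4 * π ^ 2 / (t * w)))) ≠ 0 := by
    rw [← h2]
    have h3 : eulerProd (exp (2 * π * I * (-1 / z))) =
      ∏' n, (1 - ModularForm.eta_q n (-1 / z)) := by
      simp [eulerProd, Function.Periodic.qParam, ModularForm.eta_q]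
    rw [h3]
    exact ModularForm.eta_tprod_ne_zero (by
      simpa [neg_div] using UpperHalfPlane.im_pnat_div_pos 1 ⟨z, hzim⟩)
  simp only [Function.comp, Pi.smul_apply, Pi.mul_apply, smul_eq_mul, heta, h1, h2, hsq] at h
  have hexp : exp (π ^ 2 / (6 * (t * w)) - t * w / 24) =
      exp (-(t * w) / 24) / exp (-(4 * π ^ 2 / (t * w)) / 24) := by
    rw [← exp_sub]
    congr 1
    field_simp
    ring
  have he := exp_ne_zero (-(4 * π ^ 2 / (t * w)) / 24)
  rw [hexp]
  generalize exp (-(4 * π ^ 2 / (t * w)) / 24) = A at *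
  generalize exp (-(t * w) / 24) = B at *
  generalize sqrt (I * w) = S at *
  field_simp
  linear_combination h

theorem tendsto_inv_eulerProd_zero :
    Tendsto (fun q => (eulerProd q)⁻¹) (𝓝 0) (𝓝 1) := by
  have h := (ModularForm.differentiableOn_tprod_one_sub_pow.continuousOn.continuousAt
    (Metric.ball_mem_nhds (0 : ℂ) one_pos)).tendsto
  have h0 : eulerProd 0 = 1 := by simp [eulerProd]
  have h1 : Tendsto eulerProd (𝓝 0) (𝓝 1) := by
    rw [← h0]; exact h
  simpa using h1.inv₀ one_ne_zero

/-- The factorwise estimate behind `norm_eulerProd_ge`. -/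
theorem one_sub_norm_mul_exp_le {z : ℂ} (hz : ‖z‖ ≤ 1) :
    (1 - ‖z‖) * Real.exp ((‖z‖ - z.re) / 4) ≤ ‖1 - z‖ := by
  set y := 2 * (‖z‖ - z.re) with hy
  have h1 : z.re ≤ ‖z‖ := re_le_norm z
  have h2 : -‖z‖ ≤ z.re := neg_le_of_abs_le (abs_re_le_norm z)
  have hy0 : 0 ≤ y := by linarith
  have hy4 : y / 4 ≤ 1 := by linarith
  have hexp : Real.exp (y / 4) ≤ 1 + y := by
    have h := Real.abs_exp_sub_one_le (x := y / 4) (by rw [abs_of_nonneg (by linarith)]; exact hy4)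
    rw [abs_of_nonneg (by linarith : 0 ≤ y / 4)] at h
    linarith [le_abs_self (Real.exp (y / 4) - 1)]
  have hsq : ‖1 - z‖ ^ 2 = (1 - ‖z‖) ^ 2 + y := by
    have h3 : ‖z‖ ^ 2 = z.re * z.re + z.im * z.im := by rw [Complex.sq_norm, normSq_apply]
    rw [Complex.sq_norm, normSq_apply]
    simp only [sub_re, one_re, sub_im, one_im]
    nlinarith
  refine le_of_sq_le_sq ?_ (norm_nonneg _)
  rw [mul_pow, ← Real.exp_nat_mul, show ((2 : ℕ) : ℝ) * ((‖z‖ - z.re) / 4) = y / 4 by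
    rw [hy]; push_cast; ring, hsq]
  have h5 : (1 - ‖z‖) ^ 2 ≤ 1 := by
    have := norm_nonneg z
    nlinarith
  calc (1 - ‖z‖) ^ 2 * Real.exp (y / 4) ≤ (1 - ‖z‖) ^ 2 * (1 + y) := by gcongr
    _ ≤ (1 - ‖z‖) ^ 2 + y := by nlinarith

/-- Compared with its value at `‖q‖`, the Euler product is exponentially large away from the
positive real axis. -/
theorem norm_eulerProd_ge {q : ℂ} (hq : ‖q‖ < 1) :
    ‖eulerProd (‖q‖ : ℝ)‖ * Real.exp ((‖q‖ / (1 - ‖q‖) - (q / (1 - q)).re) / 4) ≤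
      ‖eulerProd q‖ := by
  have hq' : ‖((‖q‖ : ℝ) : ℂ)‖ < 1 := by simpa using hq
  have h1 : HasSum (fun n : ℕ => ‖q‖ ^ (n + 1)) (‖q‖ / (1 - ‖q‖)) := by
    simpa [pow_succ', div_eq_mul_inv] using
      (hasSum_geometric_of_lt_one (norm_nonneg q) hq).mul_left ‖q‖
  have h2 : HasSum (fun n : ℕ => (q ^ (n + 1)).re) (q / (1 - q)).re := by
    refine Complex.hasSum_re ?_
    simpa [pow_succ', div_eq_mul_inv] using
      (hasSum_geometric_of_norm_lt_one hq).mul_left q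
  have h3 := ((h1.sub h2).div_const 4).tendsto_sum_nat
  refine le_of_tendsto_of_tendsto' ((tendsto_qPoch hq').norm.mul
    ((Real.continuous_exp.tendsto _).comp h3)) (tendsto_qPoch hq).norm fun n => ?_
  simp only [Function.comp, Real.exp_sum, qPoch, norm_prod]
  rw [← prod_mul_distrib]
  refine prod_le_prod (fun i _ => by positivity) fun i _ => ?_
  have hn : ‖q ^ (i + 1)‖ ≤ 1 := by rw [norm_pow]; exact pow_le_one₀ (norm_nonneg _) hq.le
  have h4 := one_sub_norm_mul_exp_le hn
  have h5 : ‖1 - ((‖q‖ : ℝ) : ℂ) ^ (i + 1)‖ = 1 - ‖q ^ (i + 1)‖ := by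
    rw [norm_pow, ← ofReal_pow, ← ofReal_one, ← ofReal_sub, norm_real, Real.norm_of_nonneg]
    rw [norm_pow] at hn
    linarith
  rw [h5, ← norm_pow]
  exact h4

/-! ### Estimates on the circle and Cauchy's formula -/

/-- The point `exp (-τ² (1 - i τ u))` of the circle of radius `exp (-τ²)`. In this scaling of the
angle, the saddle point of `q ^ (-n) / eulerProd q` has a Gaussian profile in `u`. -/
noncomputable def arcPoint (τ u : ℝ) : ℂ := exp (-((τ ^ 2 : ℝ) * (1 - I * (τ * u : ℝ))))

theorem arcPoint_eq (τ u : ℝ) :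
    arcPoint τ u = (Real.exp (-τ ^ 2) : ℝ) * exp ((τ ^ 3 * u : ℝ) * I) := by
  rw [arcPoint, ofReal_exp, ← exp_add]
  congr 1
  push_cast
  ring

theorem norm_arcPoint (τ u : ℝ) : ‖arcPoint τ u‖ = Real.exp (-τ ^ 2) := by
  rw [arcPoint_eq, norm_mul, norm_exp_ofReal_mul_I, mul_one, norm_real,
    Real.norm_of_nonneg (Real.exp_pos _).le]

theorem norm_arcPoint_lt_one {τ : ℝ} (hτ : 0 < τ) (u : ℝ) : ‖arcPoint τ u‖ < 1 := by
  rw [norm_arcPoint, Real.exp_lt_one_iff]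
  have := pow_pos hτ 2
  linarith

theorem arcPoint_zero (τ : ℝ) : arcPoint τ 0 = (Real.exp (-τ ^ 2) : ℝ) := by
  simp [arcPoint_eq]

theorem tendsto_arcPoint (u : ℝ) : Tendsto (fun τ => arcPoint τ u) (𝓝[>] 0) (𝓝 1) := by
  have h : Continuous fun τ => arcPoint τ u := by unfold arcPoint; fun_prop
  have h0 : arcPoint 0 u = 1 := by simp [arcPoint]
  rw [← h0]
  exact (h.tendsto 0).mono_left nhdsWithin_le_nhds

theorem half_sq_le_one_sub_exp {τ : ℝ} (hτ1 : τ ≤ 1) (hτ : 0 < τ) :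
    τ ^ 2 / 2 ≤ 1 - Real.exp (-τ ^ 2) := by
  have h1 := Real.add_one_le_exp (τ ^ 2)
  have h2 : Real.exp (τ ^ 2) * Real.exp (-τ ^ 2) = 1 := by rw [← Real.exp_add]; simp
  have h3 := Real.exp_pos (-τ ^ 2)
  have h4 : τ ^ 2 ≤ 1 := by nlinarith
  have h5 : (τ ^ 2 + 1) * Real.exp (-τ ^ 2) ≤ 1 := by nlinarith
  nlinarith [sq_nonneg τ]

/-- The arc points with `u` fixed lie in a Stolz angle at `1`. -/
theorem norm_one_sub_arcPoint_le {τ : ℝ} (hτ : 0 < τ) (hτ1 : τ ≤ 1) (u : ℝ) :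
    ‖1 - arcPoint τ u‖ ≤ (1 + 2 * |u|) * (1 - ‖arcPoint τ u‖) := by
  rw [norm_arcPoint]
  have h1 := half_sq_le_one_sub_exp hτ1 hτ
  have h2 : ‖1 - arcPoint τ u‖ ≤ (1 - Real.exp (-τ ^ 2)) + |τ ^ 3 * u| := by
    have h3 : 1 - arcPoint τ u = ((1 - Real.exp (-τ ^ 2) : ℝ) : ℂ) -
        (Real.exp (-τ ^ 2) : ℝ) * (exp (I * (τ ^ 3 * u : ℝ)) - 1) := by
      rw [arcPoint_eq, mul_comm I]
      push_cast
      ring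
    have hr : Real.exp (-τ ^ 2) ≤ 1 := Real.exp_le_one_iff.mpr (by nlinarith [sq_nonneg τ])
    rw [h3]
    refine (norm_sub_le _ _).trans (add_le_add ?_ ?_)
    · rw [norm_real, Real.norm_of_nonneg (by linarith)]
    · rw [norm_mul, norm_real, Real.norm_of_nonneg (Real.exp_pos _).le]
      exact (mul_le_of_le_one_left (norm_nonneg _) hr).trans
        Real.norm_exp_I_mul_ofReal_sub_one_le
  rw [abs_mul, abs_of_pos (pow_pos hτ 3)] at h2
  have h4 : τ ^ 3 * |u| ≤ τ ^ 2 * |u| := by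
    have : τ ^ 3 ≤ τ ^ 2 := pow_le_pow_of_le_one hτ.le hτ1 (by norm_num)
    exact mul_le_mul_of_nonneg_right this (abs_nonneg u)
  nlinarith [abs_nonneg u, mul_le_mul_of_nonneg_right h1 (abs_nonneg u)]

theorem div_one_sub_sub_re_eq {q : ℂ} (hq : ‖q‖ < 1) :
    ‖q‖ / (1 - ‖q‖) - (q / (1 - q)).re =
      (‖q‖ - q.re) * (1 + ‖q‖) / ((1 - ‖q‖) * ((1 - ‖q‖) ^ 2 + 2 * (‖q‖ - q.re))) := by
  have h1 : 1 - ‖q‖ ≠ 0 := (sub_pos.mpr hq).ne'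
  have h2 : 0 ≤ ‖q‖ - q.re := sub_nonneg.mpr (re_le_norm q)
  have h3 : (1 - ‖q‖) ^ 2 + 2 * (‖q‖ - q.re) ≠ 0 := by positivity
  have h4 : ‖q‖ ^ 2 = q.re * q.re + q.im * q.im := by rw [Complex.sq_norm, normSq_apply]
  have h5 : normSq (1 - q) = (1 - ‖q‖) ^ 2 + 2 * (‖q‖ - q.re) := by
    rw [normSq_apply]
    simp only [sub_re, one_re, sub_im, one_im]
    linear_combination -h4
  rw [div_re, h5]
  simp only [sub_re, one_re, sub_im, one_im]
  field_simp
  linear_combination (-(1 - ‖q‖)) * h4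

/-- A lower bound for the exponent in `norm_eulerProd_ge` at the arc points, from
`1 - cos θ ≥ 2 θ² / π²`. -/
theorem le_div_one_sub_sub_re_arcPoint {τ u : ℝ} (hτ : 0 < τ) (hτ1 : τ ≤ 1 / 2)
    (hu : |τ ^ 3 * u| ≤ π) :
    u ^ 2 / (1 + τ ^ 2 * u ^ 2) / 10 ≤ ‖arcPoint τ u‖ / (1 - ‖arcPoint τ u‖) -
      (arcPoint τ u / (1 - arcPoint τ u)).re := by
  have hq := norm_arcPoint_lt_one hτ u
  rw [div_one_sub_sub_re_eq hq]
  have hre : (arcPoint τ u).re = Real.exp (-τ ^ 2) * Real.cos (τ ^ 3 * u) := by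
    rw [arcPoint_eq, re_ofReal_mul, exp_ofReal_mul_I_re]
  rw [norm_arcPoint] at hq ⊢
  rw [hre]
  set r := Real.exp (-τ ^ 2) with hr
  have hexp := Real.add_one_le_exp (-τ ^ 2)
  have hr2 : 1 / 2 ≤ r := by nlinarith
  have ha : 0 < 1 - r := by linarith
  have hat : 1 - r ≤ τ ^ 2 := by linarith
  have hcos := Real.cos_le_one_sub_mul_cos_sq hu
  have hpi : 1 / 5 ≤ 2 / π ^ 2 := by
    rw [div_le_div_iff₀ (by norm_num) (by positivity)]
    nlinarith [Real.pi_lt_d2, Real.pi_pos]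
  have hcos' : Real.cos (τ ^ 3 * u) ≤ 1 - 1 / 5 * (τ ^ 3 * u) ^ 2 := by
    nlinarith [sq_nonneg (τ ^ 3 * u)]
  set g := r - r * Real.cos (τ ^ 3 * u) with hg
  have hgθ : (τ ^ 3 * u) ^ 2 / 10 ≤ g := by
    have : 0 ≤ 1 - Real.cos (τ ^ 3 * u) := by linarith [Real.cos_le_one (τ ^ 3 * u)]
    nlinarith
  have hg0 : 0 ≤ g := le_trans (by positivity) hgθ
  have ht : 0 < τ ^ 2 := by positivity
  calc u ^ 2 / (1 + τ ^ 2 * u ^ 2) / 10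
      ≤ ((τ ^ 3 * u) ^ 2 / 10) / (τ ^ 2 * ((τ ^ 2) ^ 2 + 2 * ((τ ^ 3 * u) ^ 2 / 10))) := by
        rw [div_div, div_le_div_iff₀ (by positivity) (by positivity)]
        have h1 : 0 ≤ τ ^ 8 * u ^ 4 := by positivity
        nlinarith
    _ ≤ g / (τ ^ 2 * ((τ ^ 2) ^ 2 + 2 * g)) := by
        rw [div_le_div_iff₀ (by positivity) (by positivity)]
        have h1 := mul_le_mul_of_nonneg_left hgθ (by positivity : 0 ≤ (τ ^ 2) ^ 3)
        nlinarith
    _ ≤ g / ((1 - r) * ((1 - r) ^ 2 + 2 * g)) := by gcongr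
    _ ≤ g * (1 + r) / ((1 - r) * ((1 - r) ^ 2 + 2 * g)) := by
        gcongr
        nlinarith

/-- An integrable bound, uniform in `τ`, for the decay of the integrand. On the range of `u` the
quantity `x = u² / (1 + τ² u²)` is at least of order `|u| ^ (2 / 3)` for `|u| ≥ 1`. -/
theorem exists_exp_neg_le :
    ∃ C : ℝ, ∀ τ u : ℝ, 0 < τ → |τ ^ 3 * u| ≤ π →
      (1 + 2 * |u|) * Real.exp (-(u ^ 2 / (1 + τ ^ 2 * u ^ 2) / 40)) ≤ C * (1 + u ^ 2)⁻¹ := by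
  refine ⟨2 * 83 ^ 2 * (720 * 40 ^ 6 * Real.exp (1 / 40)), fun τ u hτ hu => ?_⟩
  have hd : 0 < 1 + τ ^ 2 * u ^ 2 := by positivity
  set x := u ^ 2 / (1 + τ ^ 2 * u ^ 2) with hx
  have hx0 : 0 ≤ x := by positivity
  have hxu : u ^ 2 = x * (1 + τ ^ 2 * u ^ 2) := by rw [hx]; field_simp
  have hpi : τ ^ 6 * u ^ 2 ≤ 10 := by
    have h1 : (τ ^ 3 * u) ^ 2 ≤ π ^ 2 := sq_le_sq.mpr (by rwa [abs_of_pos Real.pi_pos])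
    have h2 : π ^ 2 ≤ 10 := by nlinarith [Real.pi_lt_d2, Real.pi_pos]
    calc τ ^ 6 * u ^ 2 = (τ ^ 3 * u) ^ 2 := by ring
      _ ≤ 10 := h1.trans h2
  have hu2 : u ^ 2 ≤ 2 * x + 80 * x ^ 3 := by
    rcases le_total (τ ^ 2 * u ^ 2) 1 with h | h
    · have : 0 ≤ x ^ 3 := by positivity
      nlinarith
    · -- here `x ≥ 1 / (2 τ²)`, while `u² ≤ 10 / τ ^ 6`
      have h1 : 1 ≤ 2 * x * τ ^ 2 := by
        have h2 : u ^ 2 ≤ u ^ 2 * (2 * x * τ ^ 2) := by nlinarith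
        have h3 : 0 < u ^ 2 := by
          rcases eq_or_ne u 0 with rfl | h0
          · norm_num at h
          · positivity
        nlinarith
      have h4 : 1 ≤ (2 * x * τ ^ 2) ^ 3 := one_le_pow₀ h1
      have h5 : u ^ 2 ≤ u ^ 2 * (2 * x * τ ^ 2) ^ 3 := le_mul_of_one_le_right (sq_nonneg u) h4
      have h6 : 0 ≤ x ^ 3 := by positivity
      nlinarith [mul_le_mul_of_nonneg_left hpi h6]
  have h1 : 1 + u ^ 2 ≤ 83 * (1 + x) ^ 3 := by nlinarith [pow_nonneg hx0 3, pow_nonneg hx0 2]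
  have h2 : 1 + 2 * |u| ≤ 2 * (1 + u ^ 2) := by
    rw [← sq_abs]; nlinarith [sq_nonneg (|u| - 1)]
  have h3 : (1 + x) ^ 6 ≤ 720 * 40 ^ 6 * Real.exp (1 / 40) * Real.exp (x / 40) := by
    have h4 := Real.pow_div_factorial_le_exp ((1 + x) / 40) (by positivity) 6
    rw [add_div, Real.exp_add, div_le_iff₀ (by positivity)] at h4
    norm_num [Nat.factorial] at h4 ⊢
    have h5 : (1 + x) ^ 6 = 40 ^ 6 * (1 / 40 + x / 40) ^ 6 := by ring
    rw [h5]
    nlinarith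
  rw [← div_eq_mul_inv, le_div_iff₀ (by positivity), Real.exp_neg, ← div_eq_mul_inv,
    div_mul_eq_mul_div, div_le_iff₀ (Real.exp_pos _)]
  calc (1 + 2 * |u|) * (1 + u ^ 2) ≤ 2 * (1 + u ^ 2) * (1 + u ^ 2) := by gcongr
    _ = 2 * (1 + u ^ 2) ^ 2 := by ring
    _ ≤ 2 * (83 * (1 + x) ^ 3) ^ 2 := by gcongr
    _ = 2 * 83 ^ 2 * (1 + x) ^ 6 := by ring
    _ ≤ 2 * 83 ^ 2 * (720 * 40 ^ 6 * Real.exp (1 / 40) * Real.exp (x / 40)) := by gcongr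
    _ = 2 * 83 ^ 2 * (720 * 40 ^ 6 * Real.exp (1 / 40)) * Real.exp (x / 40) := by ring

/-- The sum of a power series is continuous on a circle; no regularity of `G` is assumed. -/
theorem continuous_powerSeries_circle {a : ℕ → ℂ} {G : ℂ → ℂ}
    (ha : ∀ q : ℂ, ‖q‖ < 1 → HasSum (fun n => a n * q ^ n) (G q)) {g : ℝ → ℂ} {r : ℝ}
    (hr : r < 1) (hg : Continuous g) (hgr : ∀ θ, ‖g θ‖ = r) : Continuous fun θ => G (g θ) := by
  have hr0 : 0 ≤ r := (norm_nonneg _).trans_eq (hgr 0)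
  have hs : Summable fun n => ‖a n * (r : ℂ) ^ n‖ :=
    (ha r (by rwa [norm_real, Real.norm_of_nonneg hr0])).summable.norm
  have h : (fun θ => G (g θ)) = fun θ => ∑' n, a n * g θ ^ n :=
    funext fun θ => (ha _ (by rwa [hgr])).tsum_eq.symm
  rw [h]
  refine continuous_tsum (fun n => by fun_prop) hs fun n θ => le_of_eq ?_
  simp [hgr, abs_of_nonneg hr0]

theorem integral_exp_int_mul_I (k : ℤ) :
    ∫ θ in (-π)..π, exp ((k * I) * (θ : ℂ)) = (if k = 0 then 2 * π else 0 : ℂ) := by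
  split_ifs with hk
  · subst hk
    simp
    ring
  · have hc : (k : ℂ) * I ≠ 0 := mul_ne_zero (Int.cast_ne_zero.mpr hk) I_ne_zero
    rw [integral_exp_mul_complex hc, div_eq_zero_iff]
    left
    rw [sub_eq_zero, exp_eq_exp_iff_exists_int]
    exact ⟨k, by push_cast; ring⟩

/-- Cauchy's formula for the coefficients of a power series, on the circle of radius
`exp (-t)`. -/
theorem integral_powerSeries_circle {a : ℕ → ℂ} {G : ℂ → ℂ}
    (ha : ∀ q : ℂ, ‖q‖ < 1 → HasSum (fun n => a n * q ^ n) (G q)) {t : ℝ} (ht : 0 < t) (n : ℕ) :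
    ∫ θ in (-π)..π, G (exp (-(t - I * θ))) * exp (n * (t - I * θ)) = 2 * π * a n := by
  have hnorm : ∀ θ : ℝ, ‖exp (-(t - I * θ))‖ = Real.exp (-t) := fun θ => by
    rw [norm_exp]; simp
  have hnorm' : ∀ θ : ℝ, ‖exp (n * (t - I * θ))‖ = Real.exp (n * t) := fun θ => by
    rw [norm_exp]; simp
  have hlt : Real.exp (-t) < 1 := Real.exp_lt_one_iff.mpr (by linarith)
  have hs : Summable fun m => ‖a m‖ * Real.exp (-t) ^ m := by
    have := (ha (Real.exp (-t) : ℝ) (by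
      rwa [norm_real, Real.norm_of_nonneg (Real.exp_pos _).le])).summable.norm
    refine this.congr fun m => ?_
    rw [norm_mul, norm_pow, norm_real, Real.norm_of_nonneg (Real.exp_pos _).le]
  have h := intervalIntegral.hasSum_integral_of_dominated_convergence
    (F := fun (m : ℕ) (θ : ℝ) => a m * exp (-(t - I * θ)) ^ m * exp (n * (t - I * θ)))
    (f := fun θ : ℝ => G (exp (-(t - I * θ))) * exp (n * (t - I * θ)))
    (a := -π) (b := π) (μ := MeasureTheory.volume)
    (fun m _ => ‖a m‖ * Real.exp (-t) ^ m * Real.exp (n * t))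
    (fun m => Continuous.aestronglyMeasurable (by fun_prop))
    (fun m => .of_forall fun θ _ => by rw [norm_mul, norm_mul, norm_pow, hnorm, hnorm'])
    (.of_forall fun θ _ => hs.mul_right _)
    intervalIntegrable_const
    (.of_forall fun θ _ => (ha _ (by rw [hnorm]; exact hlt)).mul_right _)
  have hterm : ∀ m : ℕ, ∫ θ in (-π)..π, a m * exp (-(t - I * θ)) ^ m * exp (n * (t - I * θ)) =
      if m = n then 2 * π * a n else 0 := by
    intro m
    have h1 : ∀ θ : ℝ, a m * exp (-(t - I * θ)) ^ m * exp (n * (t - I * θ)) =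
        a m * exp ((n - m) * t) * exp ((((m : ℤ) - n : ℤ) * I) * (θ : ℂ)) := by
      intro θ
      rw [← exp_nat_mul, mul_assoc, mul_assoc, ← exp_add, ← exp_add]
      congr 2
      push_cast
      ring
    simp only [h1]
    rw [intervalIntegral.integral_const_mul, integral_exp_int_mul_I]
    by_cases hmn : m = n
    · subst hmn
      simp
      ring
    · rw [if_neg (by omega), if_neg hmn, mul_zero]
  simp only [hterm] at h
  rw [h.unique (hasSum_ite_eq n (2 * π * a n))]

/-! ### The saddle point -/

/-- The size `(τ / √(2π)) exp (π² / (3 τ²))` of `q ^ (-n) / eulerProd q` at the saddle point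
`q = exp (-τ²)`, where `n = π² / (6 τ⁴)`. -/
noncomputable def saddleValue (τ : ℝ) : ℝ :=
  Real.sqrt (τ ^ 2 / (2 * π)) * Real.exp (π ^ 2 / (3 * τ ^ 2))

theorem saddleValue_pos {τ : ℝ} (hτ : 0 < τ) : 0 < saddleValue τ := by
  have := Real.pi_pos
  unfold saddleValue
  positivity

theorem re_one_sub_I_mul (x : ℝ) : (1 - I * (x : ℂ)).re = 1 := by simp

theorem one_sub_I_mul_ne_zero (x : ℝ) : 1 - I * (x : ℂ) ≠ 0 := fun h => by
  simpa using congrArg re h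

/-- The normalized integrand `q ^ (-n) / eulerProd q` near the saddle point, by modular
inversion. -/
theorem inv_eulerProd_arcPoint_div_saddleValue {τ : ℝ} (hτ : 0 < τ) (u : ℝ) :
    (eulerProd (arcPoint τ u))⁻¹ * exp ((π ^ 2 / (6 * τ ^ 2) : ℝ) * (1 - I * (τ * u : ℝ))) /
        saddleValue τ =
      (sqrt I)⁻¹ * sqrt (I * (1 - I * (τ * u : ℝ))) *
        exp (-(π ^ 2 * u ^ 2 / (6 * (1 - I * (τ * u : ℝ)))) -
          (τ ^ 2 : ℝ) * (1 - I * (τ * u : ℝ)) / 24) *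
        (eulerProd (exp (-(4 * π ^ 2 / ((τ ^ 2 : ℝ) * (1 - I * (τ * u : ℝ)))))))⁻¹ := by
  have hτ2 : 0 < τ ^ 2 := by positivity
  have hw := one_sub_I_mul_ne_zero (τ * u)
  have hA : (saddleValue τ : ℂ) ≠ 0 := ofReal_ne_zero.mpr (saddleValue_pos hτ).ne'
  have hτ0 : (τ : ℂ) ≠ 0 := ofReal_ne_zero.mpr hτ.ne'
  rw [arcPoint, inv_eulerProd_exp_neg (τ ^ 2) hτ2 _ (by rw [re_one_sub_I_mul]; exact one_pos),
    div_eq_iff hA]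
  have hwu : (1 - I * (τ * u : ℝ) : ℂ) ^ 2 = 2 * (1 - I * (τ * u : ℝ)) - 1 - τ ^ 2 * u ^ 2 := by
    push_cast
    linear_combination (τ ^ 2 * u ^ 2 : ℂ) * I_sq
  generalize (1 - I * (τ * u : ℝ) : ℂ) = w at *
  have hexp : exp (π ^ 2 / (6 * ((τ ^ 2 : ℝ) * w)) - (τ ^ 2 : ℝ) * w / 24) *
      exp ((π ^ 2 / (6 * τ ^ 2) : ℝ) * w) =
      exp (-(π ^ 2 * u ^ 2 / (6 * w)) - (τ ^ 2 : ℝ) * w / 24) *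
        (Real.exp (π ^ 2 / (3 * τ ^ 2)) : ℝ) := by
    rw [ofReal_exp, ← exp_add, ← exp_add]
    congr 1
    push_cast
    field_simp
    linear_combination (72 * π ^ 2 : ℂ) * hwu
  rw [saddleValue, ofReal_mul]
  generalize (eulerProd (exp (-(4 * π ^ 2 / ((τ ^ 2 : ℝ) * w)))))⁻¹ = Q
  generalize sqrt (I * w) = S
  linear_combination (Real.sqrt (τ ^ 2 / (2 * π)) * (sqrt I)⁻¹ * S * Q : ℂ) * hexp

theorem sqrt_I_ne_zero : sqrt I ≠ 0 := by
  rw [sqrt_eq_exp I_ne_zero]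
  exact exp_ne_zero _

theorem tendsto_one_sub_I_mul (u : ℝ) :
    Tendsto (fun τ : ℝ => (1 - I * (τ * u : ℝ) : ℂ)) (𝓝[>] 0) (𝓝 1) := by
  have h : Continuous fun τ : ℝ => (1 - I * (τ * u : ℝ) : ℂ) := by fun_prop
  simpa using (h.tendsto 0).mono_left nhdsWithin_le_nhds

theorem tendsto_inv_eulerProd_dual (u : ℝ) :
    Tendsto (fun τ : ℝ =>
      (eulerProd (exp (-(4 * π ^ 2 / ((τ ^ 2 : ℝ) * (1 - I * (τ * u : ℝ)))))))⁻¹)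
      (𝓝[>] 0) (𝓝 1) := by
  refine tendsto_inv_eulerProd_zero.comp ?_
  rw [tendsto_zero_iff_norm_tendsto_zero]
  have h1 : ∀ τ : ℝ, ‖exp (-(4 * π ^ 2 / ((τ ^ 2 : ℝ) * (1 - I * (τ * u : ℝ)))))‖ =
      Real.exp (-(4 * π ^ 2 * (τ ^ 2)⁻¹ * ((1 - I * (τ * u : ℝ) : ℂ)⁻¹).re)) := by
    intro τ
    rw [norm_exp, ← re_ofReal_mul, ← neg_re]
    congr 2
    push_cast
    rw [div_eq_mul_inv, mul_inv]
    ring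
  simp only [h1]
  refine Real.tendsto_exp_atBot.comp (tendsto_neg_atTop_atBot.comp ?_)
  have h2 : Tendsto (fun τ : ℝ => ((1 - I * (τ * u : ℝ) : ℂ)⁻¹).re) (𝓝[>] 0) (𝓝 1) := by
    simpa only [inv_one, one_re, Function.comp_def] using
      (continuous_re.tendsto _).comp ((tendsto_one_sub_I_mul u).inv₀ one_ne_zero)
  have h3 : Tendsto (fun τ : ℝ => (τ ^ 2)⁻¹) (𝓝[>] 0) atTop := by
    refine tendsto_inv_nhdsGT_zero.comp (tendsto_nhdsWithin_iff.mpr ⟨?_, ?_⟩)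
    · have h : Continuous fun τ : ℝ => τ ^ 2 := by fun_prop
      simpa using (h.tendsto 0).mono_left nhdsWithin_le_nhds
    · filter_upwards [self_mem_nhdsWithin] with τ hτ
      exact pow_pos (Set.mem_Ioi.mp hτ) 2
  exact (h3.const_mul_atTop (by positivity)).atTop_mul_pos one_pos h2

theorem tendsto_inv_eulerProd_arcPoint_div_saddleValue (u : ℝ) :
    Tendsto (fun τ : ℝ => (eulerProd (arcPoint τ u))⁻¹ *
      exp ((π ^ 2 / (6 * τ ^ 2) : ℝ) * (1 - I * (τ * u : ℝ))) / saddleValue τ)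
      (𝓝[>] 0) (𝓝 (Real.exp (-(π ^ 2 / 6) * u ^ 2) : ℝ)) := by
  have hw := tendsto_one_sub_I_mul u
  have h1 : Tendsto (fun τ : ℝ => (sqrt I)⁻¹ * sqrt (I * (1 - I * (τ * u : ℝ)))) (𝓝[>] 0)
      (𝓝 1) := by
    have h := (continuousAt_sqrt (z := I) (by left; simp)).tendsto
    have h2 : Tendsto (fun τ : ℝ => I * (1 - I * (τ * u : ℝ) : ℂ)) (𝓝[>] 0) (𝓝 I) := by
      simpa using hw.const_mul I
    have h3 := (h.comp h2).const_mul (sqrt I)⁻¹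
    rwa [inv_mul_cancel₀ sqrt_I_ne_zero] at h3
  have h2 : Tendsto (fun τ : ℝ => exp (-(π ^ 2 * u ^ 2 / (6 * (1 - I * (τ * u : ℝ)))) -
      (τ ^ 2 : ℝ) * (1 - I * (τ * u : ℝ)) / 24)) (𝓝[>] 0)
      (𝓝 (Real.exp (-(π ^ 2 / 6) * u ^ 2) : ℝ)) := by
    have h3 : Tendsto (fun τ : ℝ => ((τ ^ 2 : ℝ) : ℂ)) (𝓝[>] 0) (𝓝 0) := by
      have h : Continuous fun τ : ℝ => ((τ ^ 2 : ℝ) : ℂ) := by fun_prop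
      simpa using (h.tendsto 0).mono_left nhdsWithin_le_nhds
    have h4 := ((tendsto_const_nhds (x := (π ^ 2 * u ^ 2 : ℂ))).div (hw.const_mul 6)
      (by norm_num)).neg.sub ((h3.mul hw).div_const 24)
    have h5 := (continuous_exp.tendsto _).comp h4
    rw [ofReal_exp]
    convert! h5 using 3
    push_cast
    ring
  have h := (h1.mul h2).mul (tendsto_inv_eulerProd_dual u)
  rw [one_mul, mul_one] at h
  refine h.congr' ?_
  filter_upwards [self_mem_nhdsWithin] with τ hτ
  exact (inv_eulerProd_arcPoint_div_saddleValue hτ u).symm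

/-- The normalized integrand is dominated through its value at `u = 0`, which tends to `1`. -/
theorem norm_inv_eulerProd_mul_exp_le :
    ∀ᶠ τ : ℝ in 𝓝[>] 0, ∀ u : ℝ, |τ ^ 3 * u| ≤ π →
      ‖(eulerProd (arcPoint τ u))⁻¹ *
        exp ((π ^ 2 / (6 * τ ^ 2) : ℝ) * (1 - I * (τ * u : ℝ))) / saddleValue τ‖ ≤
        2 * Real.exp (-(u ^ 2 / (1 + τ ^ 2 * u ^ 2) / 40)) := by
  have h0 := (tendsto_inv_eulerProd_arcPoint_div_saddleValue 0).norm
  have h1 : ‖((Real.exp (-(π ^ 2 / 6) * 0 ^ 2) : ℝ) : ℂ)‖ < 2 := by simp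
  filter_upwards [h0.eventually (gt_mem_nhds h1), self_mem_nhdsWithin,
    Ioc_mem_nhdsGT (by norm_num : (0 : ℝ) < 1 / 2)] with τ hτ2 hτ hτh u hu
  have hτ0 : 0 < τ := hτ
  have hq := norm_arcPoint_lt_one hτ0 u
  have hq0 := norm_arcPoint_lt_one hτ0 0
  have hP := norm_eulerProd_ge hq
  have hr : ((‖arcPoint τ u‖ : ℝ) : ℂ) = arcPoint τ 0 := by rw [norm_arcPoint, arcPoint_zero]
  rw [hr] at hP
  have hΔ := le_div_one_sub_sub_re_arcPoint hτ0 hτh.2 hu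
  have hpos0 : 0 < ‖eulerProd (arcPoint τ 0)‖ := norm_pos_iff.mpr (eulerProd_ne_zero hq0)
  have hE : ‖eulerProd (arcPoint τ u)‖⁻¹ ≤
      ‖eulerProd (arcPoint τ 0)‖⁻¹ * Real.exp (-(u ^ 2 / (1 + τ ^ 2 * u ^ 2) / 40)) := by
    rw [Real.exp_neg, ← mul_inv]
    refine inv_anti₀ (by positivity) (le_trans ?_ hP)
    exact mul_le_mul_of_nonneg_left (Real.exp_le_exp.mpr (by linarith)) hpos0.le
  have hnexp : ∀ v : ℝ, ‖exp ((π ^ 2 / (6 * τ ^ 2) : ℝ) * (1 - I * (τ * v : ℝ)))‖ =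
      Real.exp (π ^ 2 / (6 * τ ^ 2)) := by
    intro v
    rw [norm_exp, re_ofReal_mul, re_one_sub_I_mul, mul_one]
  rw [norm_div, norm_mul, norm_inv, hnexp] at hτ2 ⊢
  have hS : 0 < ‖(saddleValue τ : ℂ)‖ :=
    norm_pos_iff.mpr (ofReal_ne_zero.mpr (saddleValue_pos hτ0).ne')
  calc ‖eulerProd (arcPoint τ u)‖⁻¹ * Real.exp (π ^ 2 / (6 * τ ^ 2)) / ‖(saddleValue τ : ℂ)‖
      ≤ (‖eulerProd (arcPoint τ 0)‖⁻¹ * Real.exp (-(u ^ 2 / (1 + τ ^ 2 * u ^ 2) / 40))) *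
        Real.exp (π ^ 2 / (6 * τ ^ 2)) / ‖(saddleValue τ : ℂ)‖ := by gcongr
    _ = (‖eulerProd (arcPoint τ 0)‖⁻¹ * Real.exp (π ^ 2 / (6 * τ ^ 2)) / ‖(saddleValue τ : ℂ)‖) *
        Real.exp (-(u ^ 2 / (1 + τ ^ 2 * u ^ 2) / 40)) := by ring
    _ ≤ 2 * Real.exp (-(u ^ 2 / (1 + τ ^ 2 * u ^ 2) / 40)) := by gcongr

/-- The normalized integrand of Cauchy's formula for `H q / eulerProd q` on the circle of radius
`exp (-τ²)`, extended by zero. -/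
noncomputable def saddleIntegrand (H : ℂ → ℂ) (τ : ℝ) : ℝ → ℂ :=
  (Set.Ioc (-(π / τ ^ 3)) (π / τ ^ 3)).indicator fun u =>
    H (arcPoint τ u) * ((eulerProd (arcPoint τ u))⁻¹ *
      exp ((π ^ 2 / (6 * τ ^ 2) : ℝ) * (1 - I * (τ * u : ℝ))) / saddleValue τ)

/-- Dominated convergence: the Gaussian limit has integral `√(6 / π)`. -/
theorem tendsto_integral_saddleIntegrand {a : ℕ → ℂ} {H : ℂ → ℂ} {L : ℂ} {C : ℝ}
    (ha : ∀ q : ℂ, ‖q‖ < 1 → HasSum (fun n => a n * q ^ n) (H q * (eulerProd q)⁻¹))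
    (hH : ∀ q : ℂ, ‖q‖ < 1 → ‖H q‖ ≤ C * (‖1 - q‖ / (1 - ‖q‖)))
    (hlim : ∀ u : ℝ, Tendsto (fun τ => H (arcPoint τ u)) (𝓝[>] 0) (𝓝 L)) :
    Tendsto (fun τ => ∫ u, saddleIntegrand H τ u) (𝓝[>] 0) (𝓝 (L * (Real.sqrt (6 / π) : ℝ))) := by
  have hC : 0 ≤ C := by
    have h := (norm_nonneg _).trans (hH 0 (by simp))
    simpa using h
  obtain ⟨B, hB⟩ := exists_exp_neg_le
  have hgauss : ∫ u : ℝ, L * ((Real.exp (-(π ^ 2 / 6) * u ^ 2) : ℝ) : ℂ) =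
      L * (Real.sqrt (6 / π) : ℝ) := by
    have hpi := Real.pi_ne_zero
    rw [MeasureTheory.integral_const_mul, integral_complex_ofReal, integral_gaussian,
      show π / (π ^ 2 / 6) = 6 / π by field_simp]
  rw [← hgauss]
  refine MeasureTheory.tendsto_integral_filter_of_dominated_convergence
    (fun u => C * 2 * B * (1 + u ^ 2)⁻¹) ?_ ?_ (integrable_inv_one_add_sq.const_mul _) ?_
  · filter_upwards [self_mem_nhdsWithin] with τ hτ
    have hτ0 : 0 < τ := hτ
    refine (Continuous.aestronglyMeasurable ?_).indicator measurableSet_Ioc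
    have h1 : Continuous fun u => H (arcPoint τ u) * (eulerProd (arcPoint τ u))⁻¹ :=
      continuous_powerSeries_circle (G := fun q => H q * (eulerProd q)⁻¹) ha
        (Real.exp_lt_one_iff.mpr (by have := pow_pos hτ0 2; linarith) : Real.exp (-τ ^ 2) < 1)
        (by unfold arcPoint; fun_prop) (norm_arcPoint τ)
    have h2 : Continuous fun u : ℝ =>
        exp ((π ^ 2 / (6 * τ ^ 2) : ℝ) * (1 - I * (τ * u : ℝ))) / saddleValue τ := by fun_prop
    refine (h1.mul h2).congr fun u => ?_
    rw [Pi.mul_apply]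
    ring
  · filter_upwards [norm_inv_eulerProd_mul_exp_le, self_mem_nhdsWithin,
      Ioc_mem_nhdsGT (one_pos (α := ℝ))] with τ hP hτ hτ1
    have hτ0 : 0 < τ := hτ
    refine .of_forall fun u => ?_
    have hB0 : 0 ≤ B * (1 + u ^ 2)⁻¹ := by
      have h1 := hB τ 0 hτ0 (by simpa using Real.pi_pos.le)
      have h2 : 0 ≤ B := by
        simp at h1
        linarith
      positivity
    by_cases hu : u ∈ Set.Ioc (-(π / τ ^ 3)) (π / τ ^ 3)
    · rw [saddleIntegrand, Set.indicator_of_mem hu]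
      have hu' : |τ ^ 3 * u| ≤ π := by
        have h3 : 0 < τ ^ 3 := by positivity
        rw [abs_mul, abs_of_pos h3, mul_comm, ← le_div_iff₀ h3]
        exact abs_le.mpr ⟨hu.1.le, hu.2⟩
      have hq := norm_arcPoint_lt_one hτ0 u
      have h1 : ‖H (arcPoint τ u)‖ ≤ C * (1 + 2 * |u|) := by
        refine (hH _ hq).trans (mul_le_mul_of_nonneg_left ?_ hC)
        rw [div_le_iff₀ (sub_pos.mpr hq)]
        exact norm_one_sub_arcPoint_le hτ0 hτ1.2 u
      rw [norm_mul]
      calc _ ≤ C * (1 + 2 * |u|) * (2 * Real.exp (-(u ^ 2 / (1 + τ ^ 2 * u ^ 2) / 40))) := by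
            gcongr
            exact hP u hu'
        _ = C * 2 * ((1 + 2 * |u|) * Real.exp (-(u ^ 2 / (1 + τ ^ 2 * u ^ 2) / 40))) := by ring
        _ ≤ C * 2 * (B * (1 + u ^ 2)⁻¹) := by
            exact mul_le_mul_of_nonneg_left (hB τ u hτ0 hu') (by positivity)
        _ = C * 2 * B * (1 + u ^ 2)⁻¹ := by ring
    · rw [saddleIntegrand, Set.indicator_of_notMem hu, norm_zero, mul_assoc]
      positivity
  · refine .of_forall fun u => ?_
    refine ((hlim u).mul (tendsto_inv_eulerProd_arcPoint_div_saddleValue u)).congr' ?_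
    have h3 : Tendsto (fun τ : ℝ => τ ^ 3 * |u|) (𝓝[>] 0) (𝓝 0) := by
      have h : Continuous fun τ : ℝ => τ ^ 3 * |u| := by fun_prop
      simpa using (h.tendsto 0).mono_left nhdsWithin_le_nhds
    filter_upwards [h3.eventually (gt_mem_nhds Real.pi_pos), self_mem_nhdsWithin] with τ h4 hτ
    have hτ0 : 0 < τ := hτ
    have h5 : |u| < π / τ ^ 3 := by
      rw [lt_div_iff₀ (by positivity), mul_comm]
      exact h4
    have hu : u ∈ Set.Ioc (-(π / τ ^ 3)) (π / τ ^ 3) := ⟨(abs_lt.mp h5).1, (abs_lt.mp h5).2.le⟩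
    rw [saddleIntegrand, Set.indicator_of_mem hu]

/-- Cauchy's formula in the scaled angle. -/
theorem integral_saddleIntegrand {a : ℕ → ℂ} {H : ℂ → ℂ}
    (ha : ∀ q : ℂ, ‖q‖ < 1 → HasSum (fun n => a n * q ^ n) (H q * (eulerProd q)⁻¹))
    {τ : ℝ} (hτ : 0 < τ) {n : ℕ} (hn : (n : ℝ) = π ^ 2 / (6 * τ ^ 4)) :
    ∫ u, saddleIntegrand H τ u = 2 * π * a n / ((τ ^ 3 * saddleValue τ : ℝ) : ℂ) := by
  have hτ3 : 0 < τ ^ 3 := by positivity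
  have hpi := Real.pi_pos
  have hle : -(π / τ ^ 3) ≤ π / τ ^ 3 := by
    have : 0 < π / τ ^ 3 := by positivity
    linarith
  have hcauchy := integral_powerSeries_circle (G := fun q => H q * (eulerProd q)⁻¹) ha
    (pow_pos hτ 2) n
  have hsub := intervalIntegral.integral_comp_mul_left (a := -(π / τ ^ 3)) (b := π / τ ^ 3)
    (fun θ : ℝ => H (exp (-((τ ^ 2 : ℝ) - I * θ))) *
      (eulerProd (exp (-((τ ^ 2 : ℝ) - I * θ))))⁻¹ * exp (n * ((τ ^ 2 : ℝ) - I * θ))) hτ3.ne'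
  rw [show τ ^ 3 * -(π / τ ^ 3) = -π by field_simp, show τ ^ 3 * (π / τ ^ 3) = π by field_simp,
    hcauchy] at hsub
  have harg : ∀ u : ℝ, ((τ ^ 2 : ℝ) : ℂ) - I * (τ ^ 3 * u : ℝ) =
      (τ ^ 2 : ℝ) * (1 - I * (τ * u : ℝ)) := fun u => by push_cast; ring
  have hexp : ∀ u : ℝ, (n : ℂ) * ((τ ^ 2 : ℝ) * (1 - I * (τ * u : ℝ))) =
      (π ^ 2 / (6 * τ ^ 2) : ℝ) * (1 - I * (τ * u : ℝ)) := fun u => by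
    rw [← mul_assoc, ← ofReal_natCast, hn, ← ofReal_mul]
    congr 2
    field_simp
  simp only [harg, hexp, ← arcPoint.eq_1] at hsub
  have h1 : ∫ u, saddleIntegrand H τ u = ∫ u in (-(π / τ ^ 3))..(π / τ ^ 3),
      H (arcPoint τ u) * (eulerProd (arcPoint τ u))⁻¹ *
        exp ((π ^ 2 / (6 * τ ^ 2) : ℝ) * (1 - I * (τ * u : ℝ))) / saddleValue τ := by
    rw [intervalIntegral.integral_of_le hle, ← MeasureTheory.integral_indicator measurableSet_Ioc]
    unfold saddleIntegrand
    exact congrArg (fun f : ℝ → ℂ => ∫ u, f u) (Set.indicator_congr fun u _ => by ring)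
  rw [h1, intervalIntegral.integral_div, hsub, real_smul]
  push_cast
  rw [div_eq_mul_inv, div_eq_mul_inv, mul_inv]
  ring

/-- The main term, in terms of `τ` with `n = π² / (6 τ⁴)`. -/
theorem saddleValue_eq {τ : ℝ} (hτ : 0 < τ) :
    τ ^ 3 * saddleValue τ / (2 * π) * Real.sqrt (6 / π) =
      1 / (4 * Real.sqrt 3 * (π ^ 2 / (6 * τ ^ 4))) *
        Real.exp (π * Real.sqrt (2 / 3 * (π ^ 2 / (6 * τ ^ 4)))) := by
  have hpi := Real.pi_pos
  have h1 : Real.sqrt (2 / 3 * (π ^ 2 / (6 * τ ^ 4))) = π / (3 * τ ^ 2) := by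
    rw [show 2 / 3 * (π ^ 2 / (6 * τ ^ 4)) = (π / (3 * τ ^ 2)) ^ 2 by field_simp; norm_num]
    exact Real.sqrt_sq (by positivity)
  have h2 : Real.sqrt (τ ^ 2 / (2 * π)) * Real.sqrt (6 / π) = τ * Real.sqrt 3 / π := by
    rw [← Real.sqrt_mul (by positivity),
      show τ ^ 2 / (2 * π) * (6 / π) = (τ / π) ^ 2 * 3 by field_simp; norm_num,
      Real.sqrt_mul (by positivity), Real.sqrt_sq (by positivity)]
    ring
  have h3 : Real.sqrt 3 * Real.sqrt 3 = 3 := Real.mul_self_sqrt (by norm_num)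
  rw [h1, saddleValue, show π * (π / (3 * τ ^ 2)) = π ^ 2 / (3 * τ ^ 2) by ring]
  calc _ = τ ^ 3 / (2 * π) * (Real.sqrt (τ ^ 2 / (2 * π)) * Real.sqrt (6 / π)) *
        Real.exp (π ^ 2 / (3 * τ ^ 2)) := by ring
    _ = _ := by
      rw [h2]
      congr 1
      field_simp
      linear_combination 4 * h3

/-- The coefficients of `H q / eulerProd q` are asymptotically `L` times the number of partitions,
when `H` is bounded in Stolz angles at `1` and tends to `L ≠ 0` along the scaled arcs. -/
theorem isEquivalent_coeff {a : ℕ → ℝ} {H : ℂ → ℂ} {L C : ℝ} (hL : L ≠ 0)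
    (ha : ∀ q : ℂ, ‖q‖ < 1 → HasSum (fun n => (a n : ℂ) * q ^ n) (H q * (eulerProd q)⁻¹))
    (hH : ∀ q : ℂ, ‖q‖ < 1 → ‖H q‖ ≤ C * (‖1 - q‖ / (1 - ‖q‖)))
    (hlim : ∀ u : ℝ, Tendsto (fun τ => H (arcPoint τ u)) (𝓝[>] 0) (𝓝 L)) :
    Asymptotics.IsEquivalent atTop a (fun n : ℕ => L * (1 / (4 * Real.sqrt 3 * (n : ℝ)) *
      Real.exp (π * Real.sqrt (2 / 3 * (n : ℝ))))) := by
  have hpi := Real.pi_pos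
  -- the saddle point: `τ ^ 4 = π² / (6 n)`
  set τ : ℕ → ℝ := fun n => Real.sqrt (Real.sqrt (π ^ 2 / (6 * n))) with hτ
  have hτpos : ∀ n : ℕ, 0 < n → 0 < τ n := fun n hn => by
    have : (0 : ℝ) < n := Nat.cast_pos.mpr hn
    simp only [hτ]
    positivity
  have hτn : ∀ n : ℕ, 0 < n → (n : ℝ) = π ^ 2 / (6 * τ n ^ 4) := fun n hn => by
    have hn0 : (0 : ℝ) < n := Nat.cast_pos.mpr hn
    have h4 : τ n ^ 4 = π ^ 2 / (6 * n) := by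
      rw [show τ n ^ 4 = (τ n ^ 2) ^ 2 by ring, hτ, Real.sq_sqrt (Real.sqrt_nonneg _),
        Real.sq_sqrt (by positivity)]
    rw [h4]
    field_simp
  have hτlim : Tendsto τ atTop (𝓝[>] 0) := by
    refine tendsto_nhdsWithin_iff.mpr ⟨?_, ?_⟩
    · have h1 : Tendsto (fun n : ℕ => π ^ 2 / (6 * (n : ℝ))) atTop (𝓝 0) :=
        tendsto_const_nhds.div_atTop
          (tendsto_natCast_atTop_atTop.const_mul_atTop (by norm_num))
      have h2 := h1.sqrt.sqrt
      rwa [Real.sqrt_zero, Real.sqrt_zero] at h2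
    · filter_upwards [eventually_gt_atTop 0] with n hn using hτpos n hn
  have hmain := (tendsto_integral_saddleIntegrand ha hH hlim).comp hτlim
  have hre : Tendsto (fun n => 2 * π * a n / (τ n ^ 3 * saddleValue (τ n))) atTop
      (𝓝 (L * Real.sqrt (6 / π))) := by
    have h := (continuous_re.tendsto _).comp hmain
    rw [← ofReal_mul, ofReal_re] at h
    refine h.congr' ?_
    filter_upwards [eventually_gt_atTop 0] with n hn
    simp only [Function.comp]
    rw [integral_saddleIntegrand ha (hτpos n hn) (hτn n hn), ← ofReal_ofNat, ← ofReal_mul,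
      ← ofReal_mul, ← ofReal_div, ofReal_re]
  have hs0 : Real.sqrt (6 / π) ≠ 0 := by positivity
  refine Asymptotics.isEquivalent_of_tendsto_one ?_
  have hone := hre.div_const (L * Real.sqrt (6 / π))
  rw [div_self (mul_ne_zero hL hs0)] at hone
  refine hone.congr' ?_
  filter_upwards [eventually_gt_atTop 0] with n hn
  have hS := saddleValue_pos (hτpos n hn)
  have hτ0 := hτpos n hn
  simp only [Pi.div_apply]
  rw [hτn n hn, ← saddleValue_eq hτ0]
  field_simp

theorem tendsto_partialTheta_arcPoint (u : ℝ) :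
    Tendsto (fun τ => partialTheta (arcPoint τ u)) (𝓝[>] 0) (𝓝 (1 / 2)) := by
  refine tendsto_partialTheta (K := 1 + 2 * |u|) (tendsto_arcPoint u) ?_ ?_
  · filter_upwards [self_mem_nhdsWithin] with τ hτ using norm_arcPoint_lt_one hτ u
  · filter_upwards [Ioc_mem_nhdsGT (one_pos (α := ℝ))] with τ hτ
    exact norm_one_sub_arcPoint_le hτ.1 hτ.2 u

theorem isEquivalent_frobeniusNoZero :
    Asymptotics.IsEquivalent atTop (fun n : ℕ => (frobeniusNoZero n : ℝ))
      (fun n : ℕ => 1 / (8 * Real.sqrt 3 * (n : ℝ)) *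
        Real.exp (π * Real.sqrt (2 / 3 * (n : ℝ)))) := by
  have h := isEquivalent_coeff (a := fun n => (frobeniusNoZero n : ℝ)) (H := partialTheta)
    (L := 1 / 2) (C := 1) (by norm_num)
    (fun q hq => by simpa using hasSum_frobeniusNoZero hq)
    (fun q hq => by simpa using norm_partialTheta_le hq)
    (fun u => by simpa using tendsto_partialTheta_arcPoint u)
  convert h using 2 with n
  ring

theorem isEquivalent_frobeniusZero :
    Asymptotics.IsEquivalent atTop (fun n : ℕ => (frobeniusZero n : ℝ))
      (fun n : ℕ => 1 / (8 * Real.sqrt 3 * (n : ℝ)) *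
        Real.exp (π * Real.sqrt (2 / 3 * (n : ℝ)))) := by
  have hlim : ∀ u : ℝ, Tendsto (fun τ => 1 - partialTheta (arcPoint τ u)) (𝓝[>] 0)
      (𝓝 ((1 / 2 : ℝ) : ℂ)) := fun u => by
    have h := (tendsto_const_nhds (x := (1 : ℂ))).sub (tendsto_partialTheta_arcPoint u)
    refine h.trans_eq ?_
    norm_num
  have hbound : ∀ q : ℂ, ‖q‖ < 1 → ‖1 - partialTheta q‖ ≤ 2 * (‖1 - q‖ / (1 - ‖q‖)) := by
    intro q hq
    have h1 : 1 ≤ ‖1 - q‖ / (1 - ‖q‖) := by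
      rw [one_le_div (sub_pos.mpr hq)]
      simpa using norm_sub_norm_le 1 q
    have h2 := norm_sub_le 1 (partialTheta q)
    rw [norm_one] at h2
    linarith [norm_partialTheta_le hq]
  have h := isEquivalent_coeff (a := fun n => (frobeniusZero n : ℝ))
    (H := fun q => 1 - partialTheta q) (L := 1 / 2) (C := 2) (by norm_num)
    (fun q hq => by simpa using hasSum_frobeniusZero hq) hbound hlim
  convert h using 2 with n
  ring

theorem theorem1p2 :
    Asymptotics.IsEquivalent Filter.atTop
      (fun n : ℕ => (frobeniusNoZero n : ℝ)) (fun n : ℕ => (frobeniusZero n : ℝ)) ∧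
    Asymptotics.IsEquivalent Filter.atTop
      (fun n : ℕ => (frobeniusNoZero n : ℝ))
      (fun n : ℕ => 1 / (8 * Real.sqrt 3 * (n : ℝ)) *
        Real.exp (Real.pi * Real.sqrt (2 / 3 * (n : ℝ)))) ∧
    Asymptotics.IsEquivalent Filter.atTop
      (fun n : ℕ => (frobeniusZero n : ℝ))
      (fun n : ℕ => 1 / (8 * Real.sqrt 3 * (n : ℝ)) *
        Real.exp (Real.pi * Real.sqrt (2 / 3 * (n : ℝ)))) :=
  ⟨isEquivalent_frobeniusNoZero.trans isEquivalent_frobeniusZero.symm,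
    isEquivalent_frobeniusNoZero, isEquivalent_frobeniusZero⟩
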